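/- Consider the binary symmetric channel (BSC) with crossover probability $p$, $0<p<\tfrac12$, used $n$ times: inputs and outputs are $x,y\in\{\pm1\}^n$ and $p_{y|x}(b|a)=(1-p)^n\left(\frac{p}{1-p}\right)^{d_H(a,b)}$, where $d_H$ is the Hamming distance. Let $p_y(b)=2^{-n}$ be the capacity-achieving output distribution and $\Lambda(a,b)=\frac1n\ln\frac{p_{y|x}(b|a)}{p_y(b)}$. For a rate $R\in\mathbb R$ (in bits per channel use), the random coding union (RCU) bound on the average error probability is $$\overline P_e(n,R)=\mathbb E\left[\min\left(1,\,2^{nR}g(x,y)\right)\right],\qquad g(x,y)=\mathbb P_z\left[\Lambda(z,y)\ge\Lambda(x,y)\right],$$ where $x$ and $z$ are uniform on $\{\pm1\}^n$ and $y$ is the channel output for input $x$. **Theorem.** Fix $0<p<\tfrac12$ and $0<P_e<1$. For every $n\ge1$ there is a largest rate $\underline R=\underline R(n,P_e)$ with $\overline P_e(n,\underline R)\le P_e$, and it is the unique solution $R$ of $\overline P_e(n,R)=P_e$; this is the RCU lower bound on the best achievable rate. It is consistent with the normal approximation, that is, $$\underline R=C-\sqrt{\frac Vn}\,\log_2(e)\,Q^{-1}(P_e)+\frac{\log_2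 n}{2n}+O\left(\frac1n\right)\qquad(n\to\infty),$$ where $C=1+p\log_2p+(1-p)\log_2(1-p)$ is the capacity, $V=p(1-p)\ln^2\frac{1-p}{p}$ is the dispersion, and $Q^{-1}$ is the inverse of $Q(t)=\mathbb P[N(0,1)>t]$. -/

import Mathlib

open Filter Asymptotics ProbabilityTheory

noncomputable section

/-- The log-likelihood function `Λ(a, b) = (1/n) ln (p_{y|x}(b|a) / p_y(b))` of a channel with
transition probabilities `W a b = p_{y|x}(b|a)` and reference output probabilities `Py b`,
for blocklength `n`. -/
def logLikelihood {X Y : Type*} (n : ℕ) (W : X → Y → ℝ) (Py : Y → ℝ) (a : X) (b : Y) : ℝ :=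
  1 / (n : ℝ) * Real.log (W a b / Py b)

open Classical in
/-- The pairwise error function `g(x, y) = P[Λ(z, y) ≥ Λ(x, y)]`, where `z` is uniform on the
finite set `X` of codewords. -/
def pairwiseError {X Y : Type*} [Fintype X] (n : ℕ) (W : X → Y → ℝ) (Py : Y → ℝ)
    (x : X) (y : Y) : ℝ :=
  (Finset.univ.filter fun z : X => logLikelihood n W Py x y ≤ logLikelihood n W Py z y).card
    / (Fintype.card X : ℝ)

/-- The random coding union (RCU) bound on the average error probability at rate `R` (in bits per
channel use): `E[min(1, 2^{nR} g(x, y))]`, where `x` is uniform on the finite set `X` of codewords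
and `y` is the channel output for the input `x`. -/
def rcuBound {X Y : Type*} [Fintype X] [Fintype Y] (n : ℕ) (W : X → Y → ℝ) (Py : Y → ℝ)
    (R : ℝ) : ℝ :=
  ∑ x : X, 1 / (Fintype.card X : ℝ) *
    ∑ y : Y, W x y * min 1 ((2 : ℝ) ^ ((n : ℝ) * R) * pairwiseError n W Py x y)

/-- Transition probabilities of `n` uses of the binary symmetric channel with crossover
probability `p`; the alphabet `{1, -1}` is the type `ℤˣ`. -/
def bscTransition (p : ℝ) (n : ℕ) (a b : Fin n → ℤˣ) : ℝ :=
  (1 - p) ^ n * (p / (1 - p)) ^ hammingDist b a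

/-- The capacity-achieving output distribution of the binary symmetric channel (uniform). -/
def bscOutput (n : ℕ) (_b : Fin n → ℤˣ) : ℝ := (1 / 2) ^ n

/-- The RCU bound for the binary symmetric channel, as a function of the rate `R`. -/
def bscRCU (p : ℝ) (n : ℕ) (R : ℝ) : ℝ :=
  rcuBound n (bscTransition p n) (bscOutput n) R

/-- The RCU lower bound on the best achievable rate, for a given error probability `Pe`: the
largest rate at which the RCU bound guarantees an error probability of at most `Pe`. -/
def bscRCURate (p : ℝ) (n : ℕ) (Pe : ℝ) : ℝ :=
  sSup {R : ℝ | bscRCU p n R ≤ Pe}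

/-- The Gaussian tail function `Q(x) = P[N(0,1) > x]`. -/
def gaussianQ (x : ℝ) : ℝ := (gaussianReal 0 1).real (Set.Ioi x)

/-- The inverse `Q⁻¹` of the (injective) Gaussian tail function. -/
def gaussianQInv : ℝ → ℝ := Function.invFun gaussianQ

/-- The inverse is a genuine one for all probabilities strictly between `0` and `1`. -/
theorem gaussianQ_gaussianQInv {e : ℝ} (h0 : 0 < e) (h1 : e < 1) :
    gaussianQ (gaussianQInv e) = e := by
  apply Function.invFun_eq
  have hQ : ∀ x, gaussianQ x = 1 - cdf (gaussianReal 0 1) x := by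
    intro x
    rw [cdf_eq_real, gaussianQ, ← Set.compl_Iic, MeasureTheory.probReal_compl_eq_one_sub
      measurableSet_Iic]
  have hc : Continuous (cdf (gaussianReal 0 1)) := by
    rw [continuous_iff_continuousAt]
    intro x
    rw [(cdf (gaussianReal 0 1)).mono.continuousAt_iff_leftLim_eq_rightLim,
      StieltjesFunction.rightLim_eq]
    have h := StieltjesFunction.measure_singleton (cdf (gaussianReal 0 1)) x
    have := nullSingletonClass_gaussianReal (μ := 0) (v := 1) one_ne_zero
    rw [measure_cdf, MeasureTheory.measure_singleton, eq_comm, ENNReal.ofReal_eq_zero] at h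
    exact le_antisymm ((cdf (gaussianReal 0 1)).mono.leftLim_le le_rfl) (by linarith)
  obtain ⟨a, ha⟩ := ((tendsto_cdf_atBot (gaussianReal 0 1)).eventually_lt_const
    (show 0 < 1 - e by linarith)).exists
  obtain ⟨b, hb⟩ := ((tendsto_cdf_atTop (gaussianReal 0 1)).eventually_const_lt
    (show 1 - e < 1 by linarith)).exists
  obtain ⟨t, ht⟩ := mem_range_of_exists_le_of_exists_ge hc ⟨a, ha.le⟩ ⟨b, hb.le⟩
  exact ⟨t, by rw [hQ, ht]; ring⟩

/-- The normal approximation `C - √(V/n) log₂(e) Q⁻¹(Pe) + log₂(n)/(2n)`, in bits per channel use,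
for capacity `C` (in bits) and dispersion `V` (in squared nats). -/
def normalApprox (C V : ℝ) (n : ℕ) (Pe : ℝ) : ℝ :=
  C - Real.sqrt (V / n) * Real.logb 2 (Real.exp 1) * gaussianQInv Pe
    + Real.logb 2 n / (2 * n)

/-- Capacity `1 - h(p)` of the binary symmetric channel, `h` being the binary entropy in bits. -/
def bscCapacity (p : ℝ) : ℝ := 1 - Real.binEntropy p / Real.log 2

/-- Dispersion of the binary symmetric channel. -/
def bscDispersion (p : ℝ) : ℝ := p * (1 - p) * Real.log ((1 - p) / p) ^ 2

end

/-! Given the input, the output lies at a binomial(n, p) distance k from it, and higher likelihood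
means smaller distance. So the RCU bound is E[min(1, 2^{nR} G(k))], where G(k) is the proportion of
the cube in a Hamming ball of radius k (`bscRCU_eq`). In R it is continuous, and strictly increasing
while below 1, which gives the unique rate. With N the normal approximation, it remains to find a
constant D for which the bound is at most Pe at N - D/n and at least Pe at N + D/n
(`abs_bscRCURate_sub_le`).

Let x = np + √(p(1-p)n) Q⁻¹(Pe) and θ = ln((1-p)/p). At rate N, 2^{nN} times the proportion of the
sphere of radius k is exactly √n b(k) e^{(k-x)θ}, with b the binomial mass
(`two_rpow_normalApprox_mul_choose`). Within O(√n) of the mean, b(k) has order 1/√n, whence the term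
log₂(n)/(2n); and since p < 1/2 the ball is a bounded multiple of its outer sphere. Hence 2^{nN}
G(k) is e^{(k-x)θ} up to constants: the minimum saturates at 1 from about x on and decays
geometrically below. The bound is therefore P[k > x] + O(1/√n) = Pe + O(1/√n) by Berry–Esseen. An
error of that order is the mass of boundedly many k near x, so it is absorbed by moving the
threshold by a constant, that is, by scaling 2^{nR} by a constant, that is, by changing R by O(1/n).

Berry–Esseen is needed only at one fixed point. It is proved by Stein's method, with the Stein
solution controlled through the Mills ratio. The order of b(k) comes from ratios of consecutive
masses and Chebyshev's inequality, without Stirling's formula. -/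

/-! ### The RCU bound as a binomial expectation -/

/-- The binomial probability mass function. -/
noncomputable def binomialMass (p : ℝ) (n k : ℕ) : ℝ :=
  n.choose k * p ^ k * (1 - p) ^ (n - k)

/-- The proportion of `{±1}^n` in a Hamming ball of radius `k`. -/
noncomputable def ballFraction (n k : ℕ) : ℝ :=
  (∑ j ∈ Finset.range (k + 1), (n.choose j : ℝ)) / 2 ^ n

/-- Sums over `{±1}^n` of a function of the Hamming distance to a fixed point. -/
theorem sum_hammingDist {n : ℕ} (x : Fin n → ℤˣ) (F : ℕ → ℝ) :
    ∑ y : Fin n → ℤˣ, F (hammingDist y x) =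
      ∑ k ∈ Finset.range (n + 1), (n.choose k : ℝ) * F k := by
  have h := Finset.sum_powerset_apply_card F (x := (Finset.univ : Finset (Fin n)))
  simp only [Finset.card_univ, Fintype.card_fin, nsmul_eq_mul] at h
  rw [← h]
  refine Finset.sum_bij' (fun y _ => Finset.univ.filter fun i => y i ≠ x i)
    (fun s _ => fun i => if i ∈ s then -x i else x i) ?_ ?_ ?_ ?_ ?_
  · intro y _
    simp
  · intro s _
    simp
  · intro y _
    funext i
    simp only [Finset.mem_filter, Finset.mem_univ, true_and]
    split_ifs with hi
    · rcases Int.units_eq_one_or (y i) with a | a <;> rcases Int.units_eq_one_or (x i) with b | b <;>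
        simp_all
    · simpa using (not_not.mp hi).symm
  · intro s _
    ext i
    by_cases hi : i ∈ s <;> simp [hi]
  · intro y _
    simp [hammingDist]

/-- Since p < 1/2, the ratio p/(1-p) is below 1 and the likelihood decreases strictly with the
distance. -/
theorem logLikelihood_bsc_le_iff {p : ℝ} (hp0 : 0 < p) (hp1 : p < 1 / 2) {n : ℕ} (hn : 1 ≤ n)
    (x z y : Fin n → ℤˣ) :
    logLikelihood n (bscTransition p n) (bscOutput n) x y ≤
      logLikelihood n (bscTransition p n) (bscOutput n) z y ↔
    hammingDist y z ≤ hammingDist y x := by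
  have hq : 0 < 1 - p := by linarith
  have hr0 : 0 < p / (1 - p) := by positivity
  have hr1 : p / (1 - p) < 1 := by rw [div_lt_one hq]; linarith
  have hn' : (0 : ℝ) < 1 / n := by positivity
  have hpos : ∀ a, 0 < bscTransition p n a y / bscOutput n y := fun a => by
    unfold bscTransition bscOutput; positivity
  unfold logLikelihood
  rw [mul_le_mul_iff_right₀ hn', Real.log_le_log_iff (hpos x) (hpos z)]
  unfold bscTransition bscOutput
  rw [div_le_div_iff_of_pos_right (by positivity), mul_le_mul_iff_right₀ (by positivity),
    pow_le_pow_iff_right_of_lt_one₀ hr0 hr1]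

theorem pairwiseError_bsc {p : ℝ} (hp0 : 0 < p) (hp1 : p < 1 / 2) {n : ℕ} (hn : 1 ≤ n)
    (x y : Fin n → ℤˣ) :
    pairwiseError n (bscTransition p n) (bscOutput n) x y = ballFraction n (hammingDist y x) := by
  classical
  unfold pairwiseError ballFraction
  have hle : hammingDist y x ≤ n := by simpa using hammingDist_le_card_fintype (x := y) (y := x)
  have hc : (Fintype.card (Fin n → ℤˣ) : ℝ) = 2 ^ n := by simp
  rw [hc]
  congr 1
  simp only [logLikelihood_bsc_le_iff hp0 hp1 hn]
  have := sum_hammingDist y (fun d => if d ≤ hammingDist y x then (1 : ℝ) else 0)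
  rw [Finset.card_filter]
  push_cast
  simp only [hammingDist_comm y _] at this ⊢
  rw [this]
  simp only [mul_ite, mul_one, mul_zero]
  rw [← Finset.sum_filter]
  refine Finset.sum_congr ?_ fun _ _ => rfl
  ext k
  simp only [Finset.mem_filter, Finset.mem_range]
  rw [hammingDist_comm] at hle
  omega

/-- By symmetry the inner sum is the same for every codeword, so the average over codewords
disappears. -/
theorem bscRCU_eq {p : ℝ} (hp0 : 0 < p) (hp1 : p < 1 / 2) {n : ℕ} (hn : 1 ≤ n) (R : ℝ) :
    bscRCU p n R = ∑ k ∈ Finset.range (n + 1),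
      binomialMass p n k * min 1 ((2 : ℝ) ^ ((n : ℝ) * R) * ballFraction n k) := by
  have hq : 0 < 1 - p := by linarith
  unfold bscRCU rcuBound
  simp only [pairwiseError_bsc hp0 hp1 hn, bscTransition]
  simp only [fun x : Fin n → ℤˣ => sum_hammingDist x fun d => (1 - p) ^ n * (p / (1 - p)) ^ d *
    min 1 ((2 : ℝ) ^ ((n : ℝ) * R) * ballFraction n d)]
  rw [Finset.sum_const, Finset.card_univ, nsmul_eq_mul, ← mul_assoc, mul_one_div_cancel, one_mul]
  · refine Finset.sum_congr rfl fun k hk => ?_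
    have hk : k ≤ n := by simpa [Nat.lt_succ_iff] using hk
    unfold binomialMass
    rw [div_pow, ← mul_assoc]
    congr 1
    have : (1 - p) ^ n = (1 - p) ^ k * (1 - p) ^ (n - k) := by rw [← pow_add]; congr 1; omega
    rw [this]
    field_simp
  · exact_mod_cast Fintype.card_ne_zero

/-! ### Monotonicity in the rate, and the RCU rate -/

theorem binomialMass_pos {p : ℝ} (hp0 : 0 < p) (hp1 : p < 1) {n k : ℕ} (hk : k ≤ n) :
    0 < binomialMass p n k := by
  have hq : 0 < 1 - p := by linarith
  have := Nat.choose_pos hk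
  unfold binomialMass
  positivity

theorem binomialMass_nonneg {p : ℝ} (hp0 : 0 < p) (hp1 : p < 1) (n k : ℕ) :
    0 ≤ binomialMass p n k := by
  have hq : 0 < 1 - p := by linarith
  unfold binomialMass
  positivity

theorem sum_binomialMass (p : ℝ) (n : ℕ) :
    ∑ k ∈ Finset.range (n + 1), binomialMass p n k = 1 := by
  have h := add_pow p (1 - p) n
  rw [add_sub_cancel, one_pow] at h
  rw [h]
  exact Finset.sum_congr rfl fun k _ => by unfold binomialMass; ring

theorem ballFraction_pos (n k : ℕ) : 0 < ballFraction n k := by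
  unfold ballFraction
  refine div_pos (Finset.sum_pos' (fun _ _ => by positivity) ⟨0, by simp, by simp⟩) (by positivity)

theorem bscRCU_continuous {p : ℝ} (hp0 : 0 < p) (hp1 : p < 1 / 2) {n : ℕ} (hn : 1 ≤ n) :
    Continuous (bscRCU p n) := by
  rw [funext (bscRCU_eq hp0 hp1 hn)]
  refine continuous_finsetSum _ fun k _ => continuous_const.mul (continuous_const.min ?_)
  refine Continuous.mul ?_ continuous_const
  exact continuous_const.rpow (by fun_prop) fun _ => Or.inl two_ne_zero

theorem bscRCU_monotone {p : ℝ} (hp0 : 0 < p) (hp1 : p < 1 / 2) {n : ℕ} (hn : 1 ≤ n) :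
    Monotone (bscRCU p n) := by
  intro R S h
  rw [bscRCU_eq hp0 hp1 hn, bscRCU_eq hp0 hp1 hn]
  refine Finset.sum_le_sum fun k _ => ?_
  have := ballFraction_pos n k
  have := binomialMass_nonneg hp0 (by linarith) n k
  gcongr
  norm_num

/-- Equality would force every minimum to be saturated already at R, and then the bound at R would
be the total mass 1. -/
theorem bscRCU_lt_of_lt {p : ℝ} (hp0 : 0 < p) (hp1 : p < 1 / 2) {n : ℕ} (hn : 1 ≤ n) {R S : ℝ}
    (h : R < S) (hR : bscRCU p n R < 1) : bscRCU p n R < bscRCU p n S := by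
  have hmono : (2 : ℝ) ^ ((n : ℝ) * R) < (2 : ℝ) ^ ((n : ℝ) * S) := by
    have : (0 : ℝ) < n := by exact_mod_cast hn
    exact Real.rpow_lt_rpow_of_exponent_lt one_lt_two (mul_lt_mul_of_pos_left h this)
  rw [bscRCU_eq hp0 hp1 hn] at hR ⊢
  rw [bscRCU_eq hp0 hp1 hn]
  refine Finset.sum_lt_sum (fun k _ => ?_) ?_
  · have := binomialMass_nonneg hp0 (by linarith) n k
    exact mul_le_mul_of_nonneg_left (min_le_min_left _
      (mul_le_mul_of_nonneg_right hmono.le (ballFraction_pos n k).le)) this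
  · by_contra! hcon
    refine absurd hR (not_lt.mpr ?_)
    refine (sum_binomialMass p n).symm.trans_le ?_
    refine Finset.sum_le_sum fun k hk => ?_
    have hb := binomialMass_pos hp0 (by linarith) (n := n) (k := k)
      (by simpa [Nat.lt_succ_iff] using hk)
    have hG := ballFraction_pos n k
    have h1 := le_of_mul_le_mul_left (hcon k hk) hb
    rw [min_le_iff] at h1
    have h2 : (1 : ℝ) ≤ (2 : ℝ) ^ ((n : ℝ) * R) * ballFraction n k := by
      by_contra! hlt
      rw [min_eq_right hlt.le] at h1
      rcases h1 with h1 | h1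
      · linarith
      · exact absurd (mul_lt_mul_of_pos_right hmono hG) (not_lt.mpr h1)
    rw [min_eq_left h2, mul_one]

theorem exists_bscRCU_le {p : ℝ} (hp0 : 0 < p) (hp1 : p < 1 / 2) {n : ℕ} (hn : 1 ≤ n) {e : ℝ}
    (he0 : 0 < e) : ∃ R, bscRCU p n R ≤ e := by
  have hn' : (0 : ℝ) < n := by exact_mod_cast hn
  set S := ∑ k ∈ Finset.range (n + 1), binomialMass p n k * ballFraction n k with hS
  have hS0 : 0 < S := Finset.sum_pos (fun k hk => mul_pos (binomialMass_pos hp0 (by linarith)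
    (by simpa [Nat.lt_succ_iff] using hk)) (ballFraction_pos n k)) ⟨0, by simp⟩
  -- Dropping the 1 from the minimum bounds the sum by 2^{nR} S; this rate makes that equal to e.
  refine ⟨Real.logb 2 (e / S) / n, ?_⟩
  rw [bscRCU_eq hp0 hp1 hn, mul_div_cancel₀ _ hn'.ne',
    Real.rpow_logb (by norm_num) (by norm_num) (by positivity)]
  calc _ ≤ ∑ k ∈ Finset.range (n + 1), binomialMass p n k * (e / S * ballFraction n k) :=
        Finset.sum_le_sum fun k _ =>
          mul_le_mul_of_nonneg_left (min_le_right _ _) (binomialMass_nonneg hp0 (by linarith) n k)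
    _ = e / S * S := by rw [hS, Finset.mul_sum]; exact Finset.sum_congr rfl fun _ _ => by ring
    _ = e := by field_simp
    _ ≤ e := le_rfl

theorem exists_le_bscRCU {p : ℝ} (hp0 : 0 < p) (hp1 : p < 1 / 2) {n : ℕ} (hn : 1 ≤ n) :
    ∃ R, 1 ≤ bscRCU p n R := by
  -- At one bit per use, 2^n times the proportion of a ball is its cardinality, which is at least 1
  -- because of the centre.
  refine ⟨1, ?_⟩
  rw [bscRCU_eq hp0 hp1 hn]
  refine (sum_binomialMass p n).symm.trans_le ?_
  refine Finset.sum_le_sum fun k _ => ?_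
  rw [min_eq_left, mul_one]
  unfold ballFraction
  rw [mul_one, Real.rpow_natCast, mul_div_cancel₀ _ (by positivity), Finset.sum_range_succ']
  simp
  positivity

/-- The RCU rate is the greatest rate meeting the target error probability, and the unique one
at which the RCU bound equals it. -/
theorem bscRCURate_spec {p : ℝ} (hp0 : 0 < p) (hp1 : p < 1 / 2) {n : ℕ} (hn : 1 ≤ n) {e : ℝ}
    (he0 : 0 < e) (he1 : e < 1) :
    IsGreatest {R : ℝ | bscRCU p n R ≤ e} (bscRCURate p n e) ∧
      ∀ R : ℝ, bscRCU p n R = e ↔ R = bscRCURate p n e := by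
  obtain ⟨a, ha⟩ := exists_bscRCU_le hp0 hp1 hn he0
  obtain ⟨b, hb⟩ := exists_le_bscRCU hp0 hp1 hn
  obtain ⟨r, hr⟩ := mem_range_of_exists_le_of_exists_ge (bscRCU_continuous hp0 hp1 hn) ⟨a, ha⟩
    ⟨b, he1.le.trans hb⟩
  have hlt : ∀ S, r < S → e < bscRCU p n S := fun S hS => by
    rw [← hr]; exact bscRCU_lt_of_lt hp0 hp1 hn hS (by rw [hr]; exact he1)
  have hg : IsGreatest {R : ℝ | bscRCU p n R ≤ e} r :=
    ⟨hr.le, fun S hS => not_lt.mp fun h => absurd hS (not_le.mpr (hlt S h))⟩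
  have hrate : bscRCURate p n e = r := hg.csSup_eq
  rw [hrate]
  refine ⟨hg, fun R => ⟨fun hR => ?_, fun h => h ▸ hr⟩⟩
  refine (hg.2 hR.le).antisymm (not_lt.mp fun h => ?_)
  have := bscRCU_lt_of_lt hp0 hp1 hn h (by rw [hR]; exact he1)
  rw [hr, hR] at this
  exact lt_irrefl _ this

theorem abs_bscRCURate_sub_le {p : ℝ} (hp0 : 0 < p) (hp1 : p < 1 / 2) {n : ℕ} (hn : 1 ≤ n) {e : ℝ}
    (he0 : 0 < e) (he1 : e < 1) {N d : ℝ} (hlo : bscRCU p n (N - d) ≤ e)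
    (hhi : e ≤ bscRCU p n (N + d)) : |bscRCURate p n e - N| ≤ d := by
  obtain ⟨hg, hu⟩ := bscRCURate_spec hp0 hp1 hn he0 he1
  have h1 := hg.2 hlo
  have h2 : bscRCURate p n e ≤ N + d := by
    by_contra! h
    have h3 := (bscRCU_monotone hp0 hp1 hn h.le).trans hg.1
    exact h.ne ((hu _).mp (h3.antisymm hhi))
  rw [abs_le]
  constructor <;> linarith

/-! ### The Gaussian tail and the Mills ratio -/

theorem gaussianQ_eq (x : ℝ) : gaussianQ x = 1 - cdf (gaussianReal 0 1) x := by
  rw [cdf_eq_real, gaussianQ, ← Set.compl_Iic, MeasureTheory.probReal_compl_eq_one_sub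
    measurableSet_Iic]

theorem gaussianPDFReal_zero_one (x : ℝ) :
    gaussianPDFReal 0 1 x = (√(2 * Real.pi))⁻¹ * Real.exp (-x ^ 2 / 2) := by
  simp [gaussianPDFReal]

theorem gaussianPDFReal_zero_one_pos (x : ℝ) : 0 < gaussianPDFReal 0 1 x :=
  gaussianPDFReal_pos 0 1 x one_ne_zero

theorem hasDerivAt_gaussianPDFReal (x : ℝ) :
    HasDerivAt (gaussianPDFReal 0 1) (-x * gaussianPDFReal 0 1 x) x := by
  rw [funext gaussianPDFReal_zero_one]
  have h := (((hasDerivAt_pow 2 x).fun_neg.div_const 2).exp).const_mul (√(2 * Real.pi))⁻¹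
  refine h.congr_deriv ?_
  simp
  ring

theorem continuous_gaussianPDFReal : Continuous (gaussianPDFReal 0 1) :=
  continuous_iff_continuousAt.mpr fun x => (hasDerivAt_gaussianPDFReal x).continuousAt

theorem gaussianQ_eq_integral (x : ℝ) :
    gaussianQ x = ∫ t in Set.Ioi x, gaussianPDFReal 0 1 t := by
  rw [gaussianQ, MeasureTheory.Measure.real, gaussianReal_apply_eq_integral 0 one_ne_zero,
    ENNReal.toReal_ofReal]
  exact MeasureTheory.setIntegral_nonneg measurableSet_Ioi fun t _ => gaussianPDFReal_nonneg 0 1 t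

theorem hasDerivAt_gaussianQ (x : ℝ) : HasDerivAt gaussianQ (-gaussianPDFReal 0 1 x) x := by
  have hi := integrable_gaussianPDFReal 0 1
  have h : gaussianQ = fun y => gaussianQ 0 - ∫ t in (0 : ℝ)..y, gaussianPDFReal 0 1 t := by
    funext y
    rw [gaussianQ_eq_integral, gaussianQ_eq_integral,
      ← intervalIntegral.integral_Ioi_sub_Ioi' hi.integrableOn hi.integrableOn]
    ring
  rw [h]
  have := (continuous_gaussianPDFReal.integral_hasStrictDerivAt 0 x).hasDerivAt.const_sub
    (gaussianQ 0)
  exact this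

/-- The sum Q(-s) + Q(s) has zero derivative, hence is constant; its limit at infinity is 1. -/
theorem gaussianQ_neg (x : ℝ) : gaussianQ (-x) = 1 - gaussianQ x := by
  have h : ∀ t, HasDerivAt (fun s => gaussianQ (-s) + gaussianQ s) 0 t := fun t => by
    have h1 := (hasDerivAt_gaussianQ (-t)).comp t (hasDerivAt_neg t)
    refine (h1.add (hasDerivAt_gaussianQ t)).congr_deriv ?_
    simp [gaussianPDFReal_zero_one]
  have hconst := fun y => is_const_of_deriv_eq_zero (fun t => (h t).differentiableAt)
    (fun t => (h t).deriv) x y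
  have h1 : Tendsto (fun s => gaussianQ (-s) + gaussianQ s) atTop (nhds ((1 - 0) + (1 - 1))) := by
    simp only [gaussianQ_eq]
    refine Tendsto.add ?_ ?_
    · exact ((tendsto_cdf_atBot _).comp tendsto_neg_atTop_atBot).const_sub 1
    · exact (tendsto_cdf_atTop _).const_sub 1
  have h2 := tendsto_nhds_unique (tendsto_const_nhds.congr hconst) h1
  linarith

theorem gaussianQ_nonneg (x : ℝ) : 0 ≤ gaussianQ x := MeasureTheory.measureReal_nonneg

theorem gaussianQ_le_one (x : ℝ) : gaussianQ x ≤ 1 := by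
  linarith [gaussianQ_neg x, gaussianQ_nonneg (-x)]

/-- The Mills ratio of the standard Gaussian distribution. -/
noncomputable def millsRatio (x : ℝ) : ℝ := gaussianQ x / gaussianPDFReal 0 1 x

theorem millsRatio_nonneg (x : ℝ) : 0 ≤ millsRatio x :=
  div_nonneg (gaussianQ_nonneg x) (gaussianPDFReal_nonneg 0 1 x)

theorem hasDerivAt_millsRatio (x : ℝ) :
    HasDerivAt millsRatio (x * millsRatio x - 1) x := by
  have hx := (gaussianPDFReal_zero_one_pos x).ne'
  refine ((hasDerivAt_gaussianQ x).div (hasDerivAt_gaussianPDFReal x) hx).congr_deriv ?_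
  unfold millsRatio
  field_simp
  ring

/-- For x ≥ 0, replace x by t under the integral over t > x; the density φ satisfies φ' = -tφ, so
the larger integral is exactly φ(x). -/
theorem mul_gaussianQ_le (x : ℝ) : x * gaussianQ x ≤ gaussianPDFReal 0 1 x := by
  rcases le_total x 0 with hx | hx
  · exact (mul_nonpos_of_nonpos_of_nonneg hx (gaussianQ_nonneg x)).trans
      (gaussianPDFReal_nonneg 0 1 x)
  have hlim : Tendsto (gaussianPDFReal 0 1) atTop (nhds 0) := by
    rw [funext gaussianPDFReal_zero_one, ← mul_zero (√(2 * Real.pi))⁻¹]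
    refine Tendsto.const_mul _ (Real.tendsto_exp_atBot.comp ?_)
    simp_rw [neg_div]
    exact tendsto_neg_atTop_atBot.comp ((tendsto_pow_atTop two_ne_zero).atTop_div_const two_pos)
  have hd : ∀ t ∈ Set.Ioi x,
      HasDerivAt (fun s => -gaussianPDFReal 0 1 s) (t * gaussianPDFReal 0 1 t) t := fun t _ =>
    (hasDerivAt_gaussianPDFReal t).fun_neg.congr_deriv (by ring)
  have hcont : ContinuousWithinAt (fun s => -gaussianPDFReal 0 1 s) (Set.Ici x) x :=
    continuous_gaussianPDFReal.neg.continuousWithinAt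
  have hnonneg : ∀ t ∈ Set.Ioi x, 0 ≤ t * gaussianPDFReal 0 1 t := fun t ht =>
    mul_nonneg (hx.trans (le_of_lt ht)) (gaussianPDFReal_nonneg 0 1 t)
  have hint := MeasureTheory.integrableOn_Ioi_deriv_of_nonneg hcont hd hnonneg hlim.neg
  have hval := MeasureTheory.integral_Ioi_of_hasDerivAt_of_nonneg hcont hd hnonneg hlim.neg
  rw [gaussianQ_eq_integral, ← MeasureTheory.integral_const_mul]
  have hval' : ∫ t in Set.Ioi x, t * gaussianPDFReal 0 1 t = gaussianPDFReal 0 1 x := by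
    rw [hval]; ring
  rw [← hval']
  refine MeasureTheory.setIntegral_mono_on ((integrable_gaussianPDFReal 0 1).const_mul x).integrableOn
    hint measurableSet_Ioi fun t ht => ?_
  exact mul_le_mul_of_nonneg_right (le_of_lt ht) (gaussianPDFReal_nonneg 0 1 t)

theorem mul_millsRatio_le_one (x : ℝ) : x * millsRatio x ≤ 1 := by
  unfold millsRatio
  rw [← mul_div_assoc, div_le_one (gaussianPDFReal_zero_one_pos x)]
  exact mul_gaussianQ_le x

theorem millsRatio_antitone : Antitone millsRatio :=
  antitone_of_hasDerivAt_nonpos (fun x => hasDerivAt_millsRatio x) fun x => by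
    simpa using mul_millsRatio_le_one x

/-- On a right half-line, the Mills ratio and its derivative are bounded, and the second order
Taylor remainder grows at most linearly in the base point. -/
theorem exists_millsRatio_bound (a : ℝ) : ∃ C : ℝ, 1 ≤ C ∧
    (∀ w, a ≤ w → millsRatio w ≤ C) ∧ (∀ w, a ≤ w → |w * millsRatio w - 1| ≤ C) ∧
    ∀ v w, a ≤ v → a ≤ w → |v - w| ≤ 1 →
      |millsRatio v - millsRatio w - (v - w) * (w * millsRatio w - 1)| ≤
        C * (v - w) ^ 2 * (1 + |w|) := by
  -- The Mills ratio m is antitone, so it is at most m(a) on the half-line. Also 0 ≤ 1 - w m(w),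
  -- which exceeds 1 only for negative w, where |w| ≤ |a|.
  set C₀ := 1 + millsRatio a + |a| * millsRatio a with hC₀
  have ha := millsRatio_nonneg a
  have haa : 0 ≤ |a| * millsRatio a := by positivity
  have hm : ∀ w, a ≤ w → millsRatio w ≤ C₀ := fun w hw =>
    (millsRatio_antitone hw).trans (by linarith)
  have hD : ∀ w, a ≤ w → |w * millsRatio w - 1| ≤ C₀ := fun w hw => by
    rw [abs_of_nonpos (by linarith [mul_millsRatio_le_one w])]
    rcases le_total 0 w with h | h
    · have := mul_nonneg h (millsRatio_nonneg w)
      linarith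
    · have h1 : -w ≤ |a| := by rw [abs_of_nonpos (hw.trans h)]; linarith
      have := mul_le_mul h1 (millsRatio_antitone hw) (millsRatio_nonneg w) (abs_nonneg a)
      linarith
  have hC1 : 1 ≤ C₀ := by linarith
  refine ⟨2 * C₀, by linarith, fun w hw => (hm w hw).trans (by linarith),
    fun w hw => (hD w hw).trans (by linarith), fun v w hv hw hvw => ?_⟩
  have hseg : ∀ x ∈ Set.uIcc w v, a ≤ x ∧ |x - w| ≤ |v - w| := fun x hx =>
    ⟨(le_min hw hv).trans hx.1, Set.abs_sub_left_of_mem_uIcc hx⟩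
  -- The second derivative of the Mills ratio; on the segment it is at most 2C₀(1 + |w|), which
  -- gives the Taylor remainder after a second mean value estimate.
  have hD2 : ∀ x, HasDerivAt (fun x => x * millsRatio x - 1)
      (millsRatio x + x * (x * millsRatio x - 1)) x := fun x => by
    refine (((hasDerivAt_id x).mul (hasDerivAt_millsRatio x)).sub_const 1).congr_deriv ?_
    simp
  have hlip : ∀ x ∈ Set.uIcc w v,
      |(x * millsRatio x - 1) - (w * millsRatio w - 1)| ≤ 2 * C₀ * (1 + |w|) * |v - w| := by
    intro x hx
    have := Convex.norm_image_sub_le_of_norm_hasDerivWithin_le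
      (fun y _ => (hD2 y).hasDerivWithinAt) (C := 2 * C₀ * (1 + |w|)) (s := Set.uIcc w v)
      (fun y hy => ?_) (convex_uIcc w v) Set.left_mem_uIcc hx
    · simp only [Real.norm_eq_abs] at this
      refine this.trans (mul_le_mul_of_nonneg_left (hseg x hx).2 (by positivity))
    · obtain ⟨hy1, hy2⟩ := hseg y hy
      have hy3 : |y| ≤ 1 + |w| := by
        have := abs_add_le (y - w) w
        rw [sub_add_cancel] at this
        linarith
      rw [Real.norm_eq_abs]
      refine (abs_add_le _ _).trans ?_
      rw [abs_mul, abs_of_nonneg (millsRatio_nonneg y)]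
      have h1 := mul_le_mul hy3 (hD y hy1) (abs_nonneg _) (by positivity)
      have h2 : C₀ * 1 ≤ C₀ * (1 + |w|) :=
        mul_le_mul_of_nonneg_left (by linarith [abs_nonneg w]) (by linarith)
      linarith [hm y hy1]
  have hg : ∀ x, HasDerivAt (fun x => millsRatio x - x * (w * millsRatio w - 1))
      ((x * millsRatio x - 1) - (w * millsRatio w - 1)) x := fun x => by
    refine ((hasDerivAt_millsRatio x).sub ((hasDerivAt_id x).mul_const _)).congr_deriv ?_
    simp
  have := Convex.norm_image_sub_le_of_norm_hasDerivWithin_le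
      (fun y _ => (hg y).hasDerivWithinAt) (C := 2 * C₀ * (1 + |w|) * |v - w|) (s := Set.uIcc w v)
      (fun y hy => hlip y hy) (convex_uIcc w v) Set.left_mem_uIcc Set.right_mem_uIcc
  simp only [Real.norm_eq_abs] at this
  calc _ = |millsRatio v - v * (w * millsRatio w - 1) -
        (millsRatio w - w * (w * millsRatio w - 1))| := by congr 1; ring
    _ ≤ _ := this
    _ = 2 * C₀ * (1 + |w|) * |v - w| ^ 2 := by ring
    _ = _ := by rw [sq_abs]; ring

/-! ### Stein identity and moments of the binomial distribution -/

theorem binomialMass_succ {p : ℝ} {n k : ℕ} (hk : k < n) :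
    binomialMass p n (k + 1) * ((1 - p) * (k + 1)) = binomialMass p n k * (p * (n - k)) := by
  have h1 : (n.choose (k + 1) : ℝ) * (k + 1) = n.choose k * (n - k) := by
    have := Nat.choose_succ_right_eq n k
    rw [← Nat.cast_sub hk.le]
    exact_mod_cast this
  have h2 : n - k = n - (k + 1) + 1 := by omega
  unfold binomialMass
  rw [h2, pow_succ, pow_succ]
  linear_combination (p ^ k * p * (1 - p) ^ (n - (k + 1)) * (1 - p)) * h1

/-- The Stein identity of the binomial distribution. -/
theorem sum_binomialMass_mul_sub (p : ℝ) (n : ℕ) (g : ℕ → ℝ) :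
    ∑ k ∈ Finset.range (n + 1), binomialMass p n k * ((k - n * p) * g k) =
      ∑ k ∈ Finset.range (n + 1), binomialMass p n k * (p * (n - k) * (g (k + 1) - g k)) := by
  have h : ∑ k ∈ Finset.range (n + 1), binomialMass p n k * ((1 - p) * k) * g k =
      ∑ k ∈ Finset.range (n + 1), binomialMass p n k * (p * (n - k)) * g (k + 1) := by
    rw [Finset.sum_range_succ', Finset.sum_range_succ]
    simp only [Nat.cast_zero, mul_zero, zero_mul, add_zero, sub_self]
    refine Finset.sum_congr rfl fun k hk => ?_
    rw [← binomialMass_succ (Finset.mem_range.mp hk)]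
    push_cast
    ring
  rw [← sub_eq_zero] at h ⊢
  rw [← Finset.sum_sub_distrib] at h ⊢
  rw [← h]
  exact Finset.sum_congr rfl fun k _ => by ring

theorem sum_binomialMass_mul_centered (p : ℝ) (n : ℕ) :
    ∑ k ∈ Finset.range (n + 1), binomialMass p n k * (k - n * p) = 0 := by
  simpa using sum_binomialMass_mul_sub p n fun _ => 1

theorem sum_binomialMass_mul_sq (p : ℝ) (n : ℕ) :
    ∑ k ∈ Finset.range (n + 1), binomialMass p n k * (k - n * p) ^ 2 = n * p * (1 - p) := by
  have h := sum_binomialMass_mul_sub p n fun k => k - n * p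
  have h0 := sum_binomialMass_mul_centered p n
  have h1 := sum_binomialMass p n
  calc _ = ∑ k ∈ Finset.range (n + 1), binomialMass p n k * ((k - n * p) * (k - n * p)) := by
        simp only [sq]
    _ = ∑ k ∈ Finset.range (n + 1), (p * (n - n * p) * binomialMass p n k -
          p * (binomialMass p n k * (k - n * p))) := by
        rw [h]
        refine Finset.sum_congr rfl fun k _ => ?_
        push_cast
        ring
    _ = _ := by
        rw [Finset.sum_sub_distrib, ← Finset.mul_sum, ← Finset.mul_sum, h0, h1]
        ring

theorem binomial_chebyshev {p : ℝ} (hp0 : 0 < p) (hp1 : p < 1) (n : ℕ) {t : ℝ} (ht : 0 < t) :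
    ∑ k ∈ (Finset.range (n + 1)).filter (fun k : ℕ => t < |(k : ℝ) - n * p|), binomialMass p n k ≤
      n * p * (1 - p) / t ^ 2 := by
  rw [le_div_iff₀ (by positivity), Finset.sum_mul, ← sum_binomialMass_mul_sq]
  refine (Finset.sum_le_sum fun k hk => ?_).trans
    (Finset.sum_le_sum_of_subset_of_nonneg (Finset.filter_subset _ _) fun k _ _ =>
      mul_nonneg (binomialMass_nonneg hp0 hp1 n k) (sq_nonneg _))
  refine mul_le_mul_of_nonneg_left ?_ (binomialMass_nonneg hp0 hp1 n k)
  rw [← sq_abs ((k : ℝ) - n * p)]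
  exact pow_le_pow_left₀ ht.le (Finset.mem_filter.mp hk).2.le 2

/-! ### The local order of the binomial mass -/

theorem eventually_le_sqrt_natCast (K : ℝ) : ∀ᶠ n : ℕ in atTop, K ≤ √(n : ℝ) :=
  (Real.tendsto_sqrt_atTop.comp tendsto_natCast_atTop_atTop).eventually_ge_atTop K

/-- Consecutive binomial masses in a window of width of order `√n` around the mean. -/
theorem exists_binomialMass_succ_bound {p : ℝ} (hp0 : 0 < p) (hp1 : p < 1) {A : ℝ} (hA : 0 ≤ A) :
    ∃ D : ℝ, 0 ≤ D ∧ ∀ᶠ n : ℕ in atTop, ∀ k : ℕ, k < n → |(k : ℝ) - n * p| ≤ A * √n →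
      binomialMass p n k ≤ Real.exp (D / √n) * binomialMass p n (k + 1) ∧
      binomialMass p n (k + 1) ≤ Real.exp (D / √n) * binomialMass p n k := by
  have hq : 0 < 1 - p := by linarith
  have hpq : 0 < p * (1 - p) := mul_pos hp0 hq
  -- The ratio of consecutive masses is p(n-k) over (1-p)(k+1). These differ by at most (A+1)√n, and
  -- both are at least np(1-p)/2, so D/√n bounds the relative difference.
  set D := 2 * (A + 1) / (p * (1 - p)) with hD
  have hD0 : 0 ≤ D := by positivity
  refine ⟨D, hD0, ?_⟩
  filter_upwards [eventually_le_sqrt_natCast 1, eventually_le_sqrt_natCast (2 * A / (p * (1 - p)))]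
    with n hs1 hs2 k hk hku
  rw [div_le_iff₀ hpq] at hs2
  have hss : √(n : ℝ) * √n = n := Real.mul_self_sqrt (Nat.cast_nonneg n)
  set s := √(n : ℝ) with hs
  have hs0 : 0 < s := by linarith
  have hu := abs_le.mp hku
  have hb := binomialMass_nonneg hp0 hp1 n k
  have hb' := binomialMass_nonneg hp0 hp1 n (k + 1)
  have hexp : 1 + D / s ≤ Real.exp (D / s) := by linarith [Real.add_one_le_exp (D / s)]
  have hDpq : D * (p * (1 - p)) = 2 * (A + 1) := by rw [hD]; field_simp
  have hDs0 : 0 ≤ D / s := by positivity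
  have key : D / s * (n * p * (1 - p) / 2) = (A + 1) * s := by
    calc _ = D * (p * (1 - p)) / 2 * (n / s) := by ring
      _ = _ := by rw [hDpq, ← hss]; field_simp
  have hAs : A * s ≤ n * p * (1 - p) / 2 := by
    have := mul_le_mul_of_nonneg_right hs2 hs0.le
    rw [show s * (p * (1 - p)) * s = s * s * (p * (1 - p)) by ring, hss] at this
    linarith
  have hAs0 : 0 ≤ A * s := by positivity
  have hX : n * p * (1 - p) / 2 ≤ (1 - p) * (k + 1) := by
    have : (1 - p) * (-(A * s)) ≤ (1 - p) * (k - n * p) :=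
      mul_le_mul_of_nonneg_left (by linarith) hq.le
    have : (1 - p) * (A * s) ≤ 1 * (A * s) := mul_le_mul_of_nonneg_right (by linarith) hAs0
    linarith
  have hY : n * p * (1 - p) / 2 ≤ p * (n - k) := by
    have : p * (k - n * p) ≤ p * (A * s) := mul_le_mul_of_nonneg_left (by linarith) hp0.le
    have : p * (A * s) ≤ 1 * (A * s) := mul_le_mul_of_nonneg_right (by linarith) hAs0
    linarith
  have hrec := binomialMass_succ (p := p) hk
  have hn0 : 0 < n * p * (1 - p) / 2 := by
    have : 0 < (n : ℝ) := by rw [← hss]; positivity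
    positivity
  have h1 : p * (n - k) ≤ (1 + D / s) * ((1 - p) * (k + 1)) := by
    have := mul_le_mul_of_nonneg_left hX hDs0
    rw [key] at this
    linarith
  have h2 : (1 - p) * (k + 1) ≤ (1 + D / s) * (p * (n - k)) := by
    have := mul_le_mul_of_nonneg_left hY hDs0
    rw [key] at this
    linarith
  constructor
  · refine le_of_mul_le_mul_right ?_ (hn0.trans_le hY)
    rw [← hrec, mul_comm (Real.exp _), mul_assoc]
    refine mul_le_mul_of_nonneg_left (h2.trans ?_) hb'
    exact mul_le_mul_of_nonneg_right hexp (hn0.le.trans hY)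
  · refine le_of_mul_le_mul_right ?_ (hn0.trans_le hX)
    rw [hrec, mul_comm (Real.exp _), mul_assoc]
    refine mul_le_mul_of_nonneg_left (h1.trans ?_) hb
    exact mul_le_mul_of_nonneg_right hexp (hn0.le.trans hX)

/-- Two points of the window are at most 2A√n steps apart, and each step costs a factor at most
exp(D/√n). -/
theorem exists_binomialMass_le_mul {p : ℝ} (hp0 : 0 < p) (hp1 : p < 1) {A : ℝ} (hA : 0 ≤ A) :
    ∃ E : ℝ, 0 < E ∧ ∀ᶠ n : ℕ in atTop, ∀ j k : ℕ, j ≤ n → k ≤ n → |(j : ℝ) - n * p| ≤ A * √n →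
      |(k : ℝ) - n * p| ≤ A * √n → binomialMass p n j ≤ E * binomialMass p n k := by
  obtain ⟨D, hD0, hD⟩ := exists_binomialMass_succ_bound hp0 hp1 hA
  refine ⟨Real.exp (2 * A * D), Real.exp_pos _, ?_⟩
  filter_upwards [hD, eventually_le_sqrt_natCast 1] with n hn hs
  have hs0 : 0 < √(n : ℝ) := by linarith
  have step : ∀ j k : ℕ, j ≤ k → k ≤ n → |(j : ℝ) - n * p| ≤ A * √n → |(k : ℝ) - n * p| ≤ A * √n →
      binomialMass p n j ≤ Real.exp (D / √n * (k - j)) * binomialMass p n k ∧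
      binomialMass p n k ≤ Real.exp (D / √n * (k - j)) * binomialMass p n j := by
    intro j k hjk
    induction k, hjk using Nat.le_induction with
    | base => intros; simp
    | succ k hjk ih =>
      intro hk hj hk'
      have hkw : |(k : ℝ) - n * p| ≤ A * √n := by
        have : (j : ℝ) ≤ k := by exact_mod_cast hjk
        rw [abs_le] at hj hk' ⊢
        push_cast at hk'
        constructor <;> linarith
      obtain ⟨i1, i2⟩ := ih (by omega) hj hkw
      obtain ⟨s1, s2⟩ := hn k (by omega) hkw
      have hE : Real.exp (D / √n * ((k + 1 : ℕ) - j)) =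
          Real.exp (D / √n * (k - j)) * Real.exp (D / √n) := by
        rw [← Real.exp_add]; push_cast; congr 1; ring
      rw [hE]
      constructor
      · rw [mul_assoc]
        exact i1.trans (mul_le_mul_of_nonneg_left s1 (Real.exp_pos _).le)
      · refine s2.trans ?_
        rw [mul_comm (Real.exp (D / √n * (k - j))), mul_assoc]
        exact mul_le_mul_of_nonneg_left i2 (Real.exp_pos _).le
  have hbound : ∀ j k : ℕ, |(j : ℝ) - n * p| ≤ A * √n → |(k : ℝ) - n * p| ≤ A * √n →
      Real.exp (D / √n * (k - j)) ≤ Real.exp (2 * A * D) := by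
    intro j k hj hk
    rw [Real.exp_le_exp]
    have h : (k : ℝ) - j ≤ 2 * A * √n := by
      rw [abs_le] at hj hk
      linarith
    calc _ ≤ D / √n * (2 * A * √n) := mul_le_mul_of_nonneg_left h (by positivity)
      _ = _ := by field_simp
  intro j k hjn hkn hj hk
  rcases le_total j k with h | h
  · exact (step j k h hkn hj hk).1.trans
      (mul_le_mul_of_nonneg_right (hbound j k hj hk) (binomialMass_nonneg hp0 hp1 n k))
  · exact (step k j h hjn hk hj).2.trans
      (mul_le_mul_of_nonneg_right (hbound k j hk hj) (binomialMass_nonneg hp0 hp1 n k))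

/-- Near the mean, the binomial mass is of order exactly `1 / √n`. -/
theorem exists_binomialMass_window {p : ℝ} (hp0 : 0 < p) (hp1 : p < 1) (A : ℝ) :
    ∃ c C : ℝ, 0 < c ∧ 0 < C ∧ ∀ᶠ n : ℕ in atTop, ∀ k : ℕ, |(k : ℝ) - n * p| ≤ A * √n →
      k ≤ n ∧ c / √n ≤ binomialMass p n k ∧ binomialMass p n k ≤ C / √n := by
  -- A wider window gives a stronger claim. With A ≥ 2, Chebyshev leaves at least half of the mass
  -- inside, and rounding the endpoints is harmless for the count.
  wlog hA : 2 ≤ A generalizing A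
  · obtain ⟨c, C, hc, hC, h⟩ := this 2 le_rfl
    refine ⟨c, C, hc, hC, ?_⟩
    filter_upwards [h] with n hn k hk
    exact hn k (hk.trans (mul_le_mul_of_nonneg_right (by linarith) (Real.sqrt_nonneg _)))
  obtain ⟨E, hE0, hE⟩ := exists_binomialMass_le_mul hp0 hp1 (A := A) (by linarith)
  have hq : 0 < 1 - p := by linarith
  -- The window has between A√n and 3A√n points and total mass between 1/2 and 1, and its masses
  -- agree up to the factor E; compare each with the average.
  refine ⟨1 / (2 * (3 * A) * E), E / A, by positivity, by positivity, ?_⟩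
  filter_upwards [hE, eventually_le_sqrt_natCast 1, eventually_le_sqrt_natCast (A / p),
    eventually_le_sqrt_natCast (A / (1 - p))] with n hn hs1 hs2 hs3 k hk
  rw [div_le_iff₀ (by assumption)] at hs2 hs3
  have hss : √(n : ℝ) * √n = n := Real.mul_self_sqrt (Nat.cast_nonneg n)
  set s := √(n : ℝ) with hs
  have hs0 : 0 < s := by linarith
  have hAs : 2 ≤ A * s := by nlinarith
  have hlo : A * s ≤ n * p := by
    rw [← hss]; nlinarith
  have hhi : n * p + A * s ≤ n := by
    have : A * s ≤ n * (1 - p) := by rw [← hss]; nlinarith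
    linarith
  set W := Finset.Icc ⌈n * p - A * s⌉₊ ⌊n * p + A * s⌋₊ with hW
  have hmem : ∀ j : ℕ, j ∈ W ↔ |(j : ℝ) - n * p| ≤ A * s := fun j => by
    rw [hW, Finset.mem_Icc, Nat.ceil_le, Nat.le_floor_iff (by linarith), abs_le]
    constructor <;> rintro ⟨h1, h2⟩ <;> constructor <;> linarith
  have hle : ∀ j ∈ W, j ≤ n := fun j hj => by
    have := abs_le.mp ((hmem j).mp hj)
    have : (j : ℝ) ≤ n := by linarith
    exact_mod_cast this
  have hkW := (hmem k).mpr hk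
  have hcard : (W.card : ℝ) ≤ 3 * A * s ∧ A * s ≤ W.card := by
    have h1 : ⌈n * p - A * s⌉₊ ≤ ⌊n * p + A * s⌋₊ + 1 := by
      have := Finset.mem_Icc.mp hkW
      omega
    have h2 := Nat.le_ceil (n * p - A * s)
    have h3 := Nat.ceil_lt_add_one (a := n * p - A * s) (by linarith)
    have h4 := Nat.floor_le (a := n * p + A * s) (by linarith)
    have h5 := Nat.lt_floor_add_one (n * p + A * s)
    rw [hW, Nat.card_Icc, Nat.cast_sub h1]
    push_cast
    constructor <;> linarith
  have hsub : W ⊆ Finset.range (n + 1) := fun j hj => by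
    simpa [Nat.lt_succ_iff] using hle j hj
  have hsum1 : ∑ j ∈ W, binomialMass p n j ≤ 1 := by
    rw [← sum_binomialMass p n]
    exact Finset.sum_le_sum_of_subset_of_nonneg hsub fun j _ _ => binomialMass_nonneg hp0 hp1 n j
  have hsum2 : 1 / 2 ≤ ∑ j ∈ W, binomialMass p n j := by
    have h1 := binomial_chebyshev hp0 hp1 n (t := A * s) (by linarith)
    have h2 := sum_binomialMass p n
    rw [← Finset.sum_sdiff hsub] at h2
    have h3 : Finset.range (n + 1) \ W =
        (Finset.range (n + 1)).filter (fun k : ℕ => A * s < |(k : ℝ) - n * p|) := by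
      ext j
      rw [Finset.mem_sdiff, Finset.mem_filter, hmem, not_le]
    have h4 : n * p * (1 - p) / (A * s) ^ 2 ≤ 1 / 2 := by
      rw [div_le_iff₀ (by positivity), mul_pow, sq s, hss]
      have : (n : ℝ) * (p * (1 - p)) ≤ n * 1 :=
        mul_le_mul_of_nonneg_left (by nlinarith) (Nat.cast_nonneg n)
      have : (4 : ℝ) * n ≤ A ^ 2 * n :=
        mul_le_mul_of_nonneg_right (by nlinarith) (Nat.cast_nonneg n)
      have : (0 : ℝ) ≤ n := Nat.cast_nonneg n
      linarith
    rw [h3] at h2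
    linarith
  have hb := binomialMass_nonneg hp0 hp1 n k
  refine ⟨hle k hkW, ?_, ?_⟩
  · have h1 : ∑ j ∈ W, binomialMass p n j ≤ ∑ _j ∈ W, E * binomialMass p n k :=
      Finset.sum_le_sum fun j hj => hn j k (hle j hj) (hle k hkW) ((hmem j).mp hj) hk
    rw [Finset.sum_const, nsmul_eq_mul] at h1
    have h2 : W.card * (E * binomialMass p n k) ≤ 3 * A * s * (E * binomialMass p n k) :=
      mul_le_mul_of_nonneg_right hcard.1 (by positivity)
    rw [div_div, div_le_iff₀ (by positivity)]
    linarith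
  · have h1 : ∑ _j ∈ W, binomialMass p n k ≤ ∑ j ∈ W, E * binomialMass p n j :=
      Finset.sum_le_sum fun j hj => hn k j (hle k hkW) (hle j hj) hk ((hmem j).mp hj)
    rw [Finset.sum_const, nsmul_eq_mul, ← Finset.mul_sum] at h1
    have h2 : A * s * binomialMass p n k ≤ W.card * binomialMass p n k :=
      mul_le_mul_of_nonneg_right hcard.2 hb
    have h3 : E * ∑ j ∈ W, binomialMass p n j ≤ E * 1 := mul_le_mul_of_nonneg_left hsum1 hE0.le
    rw [div_div, le_div_iff₀ (by positivity)]
    linarith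

/-- Removes the lower end of the window: the masses increase up to the mean, so those to the left
are dominated by the one at the left edge. -/
theorem exists_binomialMass_le {p : ℝ} (hp0 : 0 < p) (hp1 : p < 1) (A : ℝ) :
    ∃ C : ℝ, 0 < C ∧ ∀ᶠ n : ℕ in atTop, ∀ k : ℕ, (k : ℝ) ≤ n * p + A * √n →
      binomialMass p n k ≤ C / √n := by
  obtain ⟨c, C, -, hC, h⟩ := exists_binomialMass_window hp0 hp1 (max A 1)
  refine ⟨C, hC, ?_⟩
  filter_upwards [h, eventually_le_sqrt_natCast 1, eventually_le_sqrt_natCast (max A 1 / p)]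
    with n hn hs1 hs2 k hk
  set B := max A 1
  have hB : 1 ≤ B := le_max_right _ _
  have hAB : A ≤ B := le_max_left _ _
  rw [div_le_iff₀ hp0] at hs2
  have hss : √(n : ℝ) * √n = n := Real.mul_self_sqrt (Nat.cast_nonneg n)
  set s := √(n : ℝ)
  have hk' : (k : ℝ) ≤ n * p + B * s := hk.trans (by gcongr)
  have hlo : B * s ≤ n * p := by rw [← hss]; nlinarith
  have hBs : 1 ≤ B * s := by nlinarith
  by_cases hkl : n * p - B * s ≤ k
  · exact (hn k (abs_le.mpr ⟨by linarith, by linarith⟩)).2.2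
  push Not at hkl
  have hm1 := Nat.le_ceil (n * p - B * s)
  have hm2 := Nat.ceil_lt_add_one (a := n * p - B * s) (by linarith)
  set m := ⌈n * p - B * s⌉₊
  have hm := hn m (abs_le.mpr ⟨by linarith, by linarith⟩)
  refine le_trans ?_ hm.2.2
  have hkm : k ≤ m := by
    have : (k : ℝ) < m := by linarith
    exact_mod_cast this.le
  have hmono : ∀ j, k ≤ j → j ≤ m → binomialMass p n k ≤ binomialMass p n j := by
    intro j hkj
    induction j, hkj using Nat.le_induction with
    | base => intro _; exact le_rfl
    | succ j hkj ih =>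
      intro hj
      refine (ih (by omega)).trans ?_
      have hjn : j < n := by omega
      have hj' : (j : ℝ) + 1 ≤ m := by exact_mod_cast hj
      have hrec := binomialMass_succ (p := p) hjn
      have hq : 0 < (1 - p) * ((j : ℝ) + 1) := mul_pos (by linarith) (by positivity)
      refine le_of_mul_le_mul_right ?_ hq
      rw [hrec]
      refine mul_le_mul_of_nonneg_left ?_ (binomialMass_nonneg hp0 hp1 n j)
      linarith
  exact hmono m hkm le_rfl

/-! ### Stein's method and the Berry–Esseen bound -/

/-- The bounded solution of the Stein equation of the indicator of `(-∞, z]`. -/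
noncomputable def steinSolution (z w : ℝ) : ℝ :=
  if w ≤ z then gaussianQ z * millsRatio (-w) else (1 - gaussianQ z) * millsRatio w

/-- The derivative of `steinSolution`, as given by the Stein equation. -/
noncomputable def steinDeriv (z w : ℝ) : ℝ :=
  w * steinSolution z w + (if w ≤ z then 1 else 0) - (1 - gaussianQ z)

theorem steinDeriv_of_le {z w : ℝ} (h : w ≤ z) :
    steinDeriv z w = gaussianQ z * -(-w * millsRatio (-w) - 1) := by
  simp only [steinDeriv, steinSolution, if_pos h]
  ring

theorem steinDeriv_of_lt {z w : ℝ} (h : z < w) :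
    steinDeriv z w = (1 - gaussianQ z) * (w * millsRatio w - 1) := by
  simp only [steinDeriv, steinSolution, if_neg h.not_ge]
  ring

/-- The two branches agree at z, so the solution is continuous there. -/
theorem steinSolution_self (z : ℝ) : steinSolution z z = (1 - gaussianQ z) * millsRatio z := by
  have h : gaussianPDFReal 0 1 (-z) = gaussianPDFReal 0 1 z := by simp [gaussianPDFReal_zero_one]
  rw [steinSolution, if_pos le_rfl, millsRatio, millsRatio, gaussianQ_neg, h]
  ring

/-- Away from z the solution is a Mills ratio times a factor in [0, 1], and Taylor's estimate
applies. The derivative jumps at z, so a step across z has only a linear error; this suffices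
because at most one lattice step crosses. -/
theorem exists_steinSolution_bound (z : ℝ) : ∃ C K : ℝ, 0 ≤ C ∧ 0 ≤ K ∧
    (∀ w, |steinDeriv z w| ≤ C) ∧
    (∀ w d, 0 ≤ d → d ≤ 1 → w + d ≤ z ∨ z < w →
      |steinSolution z (w + d) - steinSolution z w - d * steinDeriv z w| ≤
        C * d ^ 2 * (1 + |w|)) ∧
    ∀ w d, 0 ≤ d → d ≤ 1 → w ≤ z → z < w + d →
      |steinSolution z (w + d) - steinSolution z w - d * steinDeriv z w| ≤ K * d := by
  -- Both branches evaluate the Mills ratio at arguments at least -|z|: at -w when w ≤ z, at w when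
  -- w > z.
  obtain ⟨C, hC1, -, hD, hT⟩ := exists_millsRatio_bound (-|z|)
  have hQ0 := gaussianQ_nonneg z
  have hQ1 := gaussianQ_le_one z
  have hz1 := le_abs_self z
  have hz2 := neg_abs_le z
  have hbound : ∀ {t x y : ℝ}, 0 ≤ t → t ≤ 1 → |x| ≤ y → |t * x| ≤ y := fun {t x y} h0 h1 h => by
    rw [abs_mul, abs_of_nonneg h0]
    exact (mul_le_of_le_one_left (abs_nonneg x) h1).trans h
  have hD' : ∀ w, |steinDeriv z w| ≤ C := fun w => by
    rcases le_or_gt w z with h | h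
    · rw [steinDeriv_of_le h]
      exact hbound hQ0 hQ1 (by rw [abs_neg]; exact hD _ (by linarith))
    · rw [steinDeriv_of_lt h]
      exact hbound (by linarith) (by linarith) (hD _ (by linarith))
  have hT' : ∀ w d, 0 ≤ d → d ≤ 1 → w + d ≤ z ∨ z < w →
      |steinSolution z (w + d) - steinSolution z w - d * steinDeriv z w| ≤
        C * d ^ 2 * (1 + |w|) := fun w d hd0 hd1 h => by
    rcases h with h | h
    · rw [steinDeriv_of_le (by linarith), steinSolution, steinSolution, if_pos h,
        if_pos (by linarith)]
      have := hT (-(w + d)) (-w) (by linarith) (by linarith) (by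
        rw [show -(w + d) - -w = -d by ring, abs_neg, abs_of_nonneg hd0]; exact hd1)
      rw [show -(w + d) - -w = -d by ring, neg_sq, abs_neg] at this
      refine le_trans (le_of_eq ?_) (hbound hQ0 hQ1 this)
      congr 1
      ring
    · rw [steinDeriv_of_lt h, steinSolution, steinSolution, if_neg (by linarith),
        if_neg (by linarith)]
      have := hT (w + d) w (by linarith) (by linarith) (by
        rw [add_sub_cancel_left, abs_of_nonneg hd0]; exact hd1)
      rw [add_sub_cancel_left] at this
      refine le_trans (le_of_eq ?_) (hbound (t := 1 - gaussianQ z) (by linarith) (by linarith) this)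
      congr 1
      ring
  refine ⟨C, C * (2 + |z|) + C * (3 + |z|) + C, by linarith, by positivity, hD', hT',
    fun w d hd0 hd1 hwz hzd => ?_⟩
  have h1 : |steinSolution z (w + d) - steinSolution z z| ≤ C * (2 + |z|) * d := by
    rw [steinSolution_self, steinSolution, if_neg (by linarith), ← mul_sub]
    refine hbound (by linarith) (by linarith) ?_
    set e := w + d - z with he
    have he0 : 0 ≤ e := by linarith
    have hed : e ≤ d := by linarith
    have h := hT (w + d) z (by linarith) (by linarith) (by rw [abs_of_nonneg he0]; linarith)
    have h2 : |e * (z * millsRatio z - 1)| ≤ e * C := by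
      rw [abs_mul, abs_of_nonneg he0]
      exact mul_le_mul_of_nonneg_left (hD z (by linarith)) he0
    have h3 := abs_add_le (millsRatio (w + d) - millsRatio z - e * (z * millsRatio z - 1))
      (e * (z * millsRatio z - 1))
    rw [sub_add_cancel] at h3
    have h4 : C * e ^ 2 * (1 + |z|) ≤ C * d * (1 + |z|) := by
      have : e ^ 2 ≤ d := by nlinarith
      gcongr
    have h5 : e * C ≤ d * C := by gcongr
    linarith
  have h2 : |steinSolution z z - steinSolution z w| ≤ C * (3 + |z|) * d := by
    set e := z - w with he
    have he0 : 0 ≤ e := by linarith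
    have hed : e ≤ d := by linarith
    have hwe : w + e = z := by rw [he]; ring
    have h := hT' w e he0 (by linarith) (Or.inl hwe.le)
    rw [hwe] at h
    have h2 : |e * steinDeriv z w| ≤ e * C := by
      rw [abs_mul, abs_of_nonneg he0]
      exact mul_le_mul_of_nonneg_left (hD' w) he0
    have h3 := abs_add_le (steinSolution z z - steinSolution z w - e * steinDeriv z w)
      (e * steinDeriv z w)
    rw [sub_add_cancel] at h3
    have hw : |w| ≤ |z| + 1 := by
      rw [abs_le]
      constructor <;> linarith
    have h4 : C * e ^ 2 * (1 + |w|) ≤ C * d * (2 + |z|) := by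
      have : e ^ 2 ≤ d := by nlinarith
      have : 1 + |w| ≤ 2 + |z| := by linarith
      gcongr
    have h5 : e * C ≤ d * C := by gcongr
    linarith
  have h3 : |d * steinDeriv z w| ≤ C * d := by
    rw [abs_mul, abs_of_nonneg hd0, mul_comm]
    exact mul_le_mul_of_nonneg_right (hD' w) hd0
  calc _ = |(steinSolution z (w + d) - steinSolution z z) +
        (steinSolution z z - steinSolution z w) - d * steinDeriv z w| := by congr 1; ring
    _ ≤ _ := (abs_sub _ _).trans (add_le_add_left (abs_add_le _ _) _)
    _ ≤ _ := by linarith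

/-- The Berry–Esseen bound for the binomial distribution, at a fixed point. -/
theorem exists_binomial_berryEsseen {p : ℝ} (hp0 : 0 < p) (hp1 : p < 1) (z : ℝ) :
    ∃ C : ℝ, 0 ≤ C ∧ ∀ᶠ n : ℕ in atTop,
      |∑ k ∈ (Finset.range (n + 1)).filter
          (fun k : ℕ => n * p + √(p * (1 - p)) * √n * z < (k : ℝ)), binomialMass p n k -
        gaussianQ z| ≤ C / √n := by
  have hq : 0 < 1 - p := by linarith
  have hpq : 0 < p * (1 - p) := mul_pos hp0 hq
  obtain ⟨C, K, hC, hK, hD, hT, hX⟩ := exists_steinSolution_bound z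
  obtain ⟨B, hB, hmass⟩ := exists_binomialMass_le hp0 hp1 |z|
  set τ := √(p * (1 - p)) with hτ
  have hτ0 : 0 < τ := Real.sqrt_pos.mpr hpq
  have hττ : τ * τ = p * (1 - p) := Real.mul_self_sqrt hpq.le
  have hτ1 : τ ≤ 1 := by nlinarith
  refine ⟨(p * C + 1 / (1 - p) * C * 2) / τ + 1 / (1 - p) * K * B, by positivity, ?_⟩
  filter_upwards [hmass, eventually_le_sqrt_natCast (1 / τ), eventually_le_sqrt_natCast 1]
    with n hmass hs1 hs2
  have hss : √(n : ℝ) * √n = n := Real.mul_self_sqrt (Nat.cast_nonneg n)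
  set s := √(n : ℝ) with hs
  have hs0 : 0 < s := by linarith
  set σ := τ * s with hσ
  have hσ1 : 1 ≤ σ := by rw [div_le_iff₀ hτ0] at hs1; rw [hσ]; linarith
  have hσ0 : 0 < σ := by linarith
  have hσσ : σ * σ = n * p * (1 - p) := by
    rw [hσ, show τ * s * (τ * s) = (τ * τ) * (s * s) by ring, hττ, hss]; ring
  set δ := 1 / σ with hδ
  have hδ0 : 0 ≤ δ := by positivity
  have hδ1 : δ ≤ 1 := by rw [hδ, div_le_one hσ0]; exact hσ1
  have hσδ : σ * δ = 1 := by rw [hδ]; field_simp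
  set W : ℕ → ℝ := fun k => (k - n * p) * δ with hW
  have hWs : ∀ k, W (k + 1) = W k + δ := fun k => by simp only [hW]; push_cast; ring
  have hkW : ∀ k : ℕ, (k : ℝ) - n * p = σ * W k := fun k => by
    simp only [hW]; linear_combination -((k : ℝ) - n * p) * hσδ
  set b := binomialMass p n with hb
  have hb0 : ∀ k, 0 ≤ b k := binomialMass_nonneg hp0 hp1 n
  -- The only index whose step from W k to W (k + 1) can cross z; its mass is O(1/√n).
  set k₀ := ⌊n * p + σ * z⌋₊ with hk₀
  set r : ℕ → ℝ := fun k => steinSolution z (W (k + 1)) - steinSolution z (W k) -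
    δ * steinDeriv z (W k) with hr
  have hrb : ∀ k, |r k| ≤ C * δ ^ 2 * (1 + |W k|) + if k = k₀ then K * δ else 0 := fun k => by
    simp only [hr, hWs]
    have hite : 0 ≤ if k = k₀ then K * δ else 0 := by split_ifs <;> positivity
    by_cases hcross : W k + δ ≤ z ∨ z < W k
    · have := hT (W k) δ hδ0 hδ1 hcross
      linarith
    · push Not at hcross
      have h := hX (W k) δ hδ0 hδ1 hcross.2 hcross.1
      have hk : k = k₀ := by
        have h1 := mul_le_mul_of_nonneg_left hcross.2 hσ0.le
        have h2 := mul_lt_mul_of_pos_left hcross.1 hσ0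
        rw [mul_add, hσδ, ← hkW] at h2
        rw [← hkW] at h1
        have h3 : (0 : ℝ) ≤ k := Nat.cast_nonneg k
        rw [hk₀, eq_comm, Nat.floor_eq_iff (by linarith)]
        constructor <;> linarith
      have : 0 ≤ C * δ ^ 2 * (1 + |W k|) := by positivity
      rw [if_pos hk]
      linarith
  have hsum1 : ∑ k ∈ Finset.range (n + 1), b k = 1 := sum_binomialMass p n
  have hsumW : ∑ k ∈ Finset.range (n + 1), b k * W k ^ 2 = 1 := by
    have h := sum_binomialMass_mul_sq p n
    simp only [hkW, mul_pow] at h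
    have h2 : ∑ k ∈ Finset.range (n + 1), b k * W k ^ 2 * (σ * σ) = n * p * (1 - p) := by
      rw [← h]
      exact Finset.sum_congr rfl fun k _ => by ring
    rw [← Finset.sum_mul, ← hσσ] at h2
    exact mul_right_cancel₀ (by positivity : σ * σ ≠ 0) (by rw [h2, one_mul])
  have hsumabs : ∑ k ∈ Finset.range (n + 1), b k * |W k| ≤ 1 := by
    calc _ ≤ ∑ k ∈ Finset.range (n + 1), (b k + b k * W k ^ 2) / 2 := by
          refine Finset.sum_le_sum fun k _ => ?_
          have : 0 ≤ b k * (1 - |W k|) ^ 2 := mul_nonneg (hb0 k) (sq_nonneg _)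
          rw [sub_sq, sq_abs] at this
          linarith
      _ = 1 := by rw [← Finset.sum_div, Finset.sum_add_distrib, hsum1, hsumW]; norm_num
  have hstein := sum_binomialMass_mul_sub p n fun k => steinSolution z (W k)
  -- With f the Stein solution, the left side is E[f'(W) - W f(W)]. The Stein identity turns E[W
  -- f(W)] into E[p(n-k)δ (f(W+δ) - f(W))], and p(n-k)δ² = 1 - pδW, so the main terms cancel.
  have hexpr : gaussianQ z - ∑ k ∈ (Finset.range (n + 1)).filter
      (fun k : ℕ => n * p + σ * z < (k : ℝ)), b k =
      ∑ k ∈ Finset.range (n + 1), b k * (p * δ * W k * steinDeriv z (W k) -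
        p * (n - k) * δ * r k) := by
    have h1 : ∑ k ∈ (Finset.range (n + 1)).filter (fun k : ℕ => n * p + σ * z < (k : ℝ)), b k =
        ∑ k ∈ Finset.range (n + 1), b k * (1 - if W k ≤ z then 1 else 0) := by
      rw [Finset.sum_filter]
      refine Finset.sum_congr rfl fun k _ => ?_
      have : W k ≤ z ↔ ¬ (n * p + σ * z < (k : ℝ)) := by
        rw [not_lt, ← mul_le_mul_iff_right₀ hσ0, ← hkW]
        constructor <;> intro <;> linarith
      by_cases h : n * p + σ * z < (k : ℝ) <;> simp [h, this]
    have h2 : ∑ k ∈ Finset.range (n + 1), b k * ((k - n * p) * steinSolution z (W k)) * δ =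
        ∑ k ∈ Finset.range (n + 1), b k * (p * (n - k) * (steinSolution z (W (k + 1)) -
          steinSolution z (W k))) * δ := by
      rw [← Finset.sum_mul, ← Finset.sum_mul, hstein]
    have hpt : ∀ k, b k * gaussianQ z - b k * (1 - if W k ≤ z then 1 else 0) =
        b k * (p * δ * W k * steinDeriv z (W k) - p * (n - k) * δ * r k) -
        (b k * ((k - n * p) * steinSolution z (W k)) * δ -
          b k * (p * (n - k) * (steinSolution z (W (k + 1)) - steinSolution z (W k))) * δ) := by
      intro k
      have hone : p * δ * W k + p * (n - k) * δ * δ = 1 := by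
        calc _ = n * p * (1 - p) * (δ * δ) := by simp only [hW]; ring
          _ = (σ * δ) * (σ * δ) := by rw [← hσσ]; ring
          _ = 1 := by rw [hσδ, one_mul]
      have hWk : (k - n * p) * δ = W k := rfl
      simp only [hr]
      have hdef : steinDeriv z (W k) = W k * steinSolution z (W k) +
        (if W k ≤ z then 1 else 0) - (1 - gaussianQ z) := rfl
      linear_combination (-(b k * steinDeriv z (W k))) * hone + b k * steinSolution z (W k) * hWk
        - b k * hdef
    have hQ : gaussianQ z = ∑ k ∈ Finset.range (n + 1), b k * gaussianQ z := by
      rw [← Finset.sum_mul, hsum1, one_mul]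
    rw [h1, hQ, ← Finset.sum_sub_distrib, Finset.sum_congr rfl fun k _ => hpt k,
      Finset.sum_sub_distrib, Finset.sum_sub_distrib, h2, sub_self, sub_zero]
  rw [abs_sub_comm, hexpr]
  have hnpδ : n * p * δ * δ = 1 / (1 - p) := by
    rw [eq_div_iff hq.ne']
    calc _ = n * p * (1 - p) * (δ * δ) := by ring
      _ = (σ * δ) * (σ * δ) := by rw [← hσσ]; ring
      _ = 1 := by rw [hσδ, one_mul]
  have hterm : ∀ k ∈ Finset.range (n + 1), |b k * (p * δ * W k * steinDeriv z (W k) -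
        p * (n - k) * δ * r k)| ≤ p * C * δ * (b k * |W k|) +
        1 / (1 - p) * C * δ * (b k + b k * |W k|) +
        if k = k₀ then 1 / (1 - p) * K * b k else 0 := by
    intro k hk
    have hkn : (k : ℝ) ≤ n := by
      have := Finset.mem_range.mp hk
      exact_mod_cast Nat.lt_succ_iff.mp this
    rw [abs_mul, abs_of_nonneg (hb0 k)]
    have h1 : |p * δ * W k * steinDeriv z (W k)| ≤ p * δ * |W k| * C := by
      rw [abs_mul, abs_mul, abs_of_nonneg (by positivity : 0 ≤ p * δ)]
      exact mul_le_mul_of_nonneg_left (hD _) (by positivity)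
    have h2 : |p * (n - k) * δ * r k| ≤ n * p * δ * (C * δ ^ 2 * (1 + |W k|) +
        if k = k₀ then K * δ else 0) := by
      have h0 : 0 ≤ p * (n - k) * δ := mul_nonneg (mul_nonneg hp0.le (by linarith)) hδ0
      rw [abs_mul, abs_of_nonneg h0]
      refine mul_le_mul ?_ (hrb k) (abs_nonneg _) (by positivity)
      refine mul_le_mul_of_nonneg_right ?_ hδ0
      have : 0 ≤ p * (k : ℝ) := by positivity
      linarith
    refine (mul_le_mul_of_nonneg_left ((abs_sub _ _).trans (add_le_add h1 h2)) (hb0 k)).trans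
      (le_of_eq ?_)
    rw [← hnpδ]
    split_ifs <;> ring
  refine (Finset.abs_sum_le_sum_abs _ _).trans ((Finset.sum_le_sum hterm).trans ?_)
  rw [Finset.sum_add_distrib, Finset.sum_add_distrib, ← Finset.mul_sum, ← Finset.mul_sum,
    Finset.sum_add_distrib, hsum1]
  have hlast : ∑ k ∈ Finset.range (n + 1), (if k = k₀ then 1 / (1 - p) * K * b k else 0) ≤
      1 / (1 - p) * K * (B / s) := by
    have hbk : b k₀ ≤ B / s := by
      refine hmass k₀ ?_
      have hzz : σ * z ≤ |z| * s := by
        calc σ * z ≤ σ * |z| := mul_le_mul_of_nonneg_left (le_abs_self z) hσ0.le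
          _ = τ * (s * |z|) := by rw [hσ]; ring
          _ ≤ 1 * (s * |z|) := mul_le_mul_of_nonneg_right hτ1 (by positivity)
          _ = _ := by ring
      rcases le_total 0 (n * p + σ * z) with h | h
      · exact (Nat.floor_le h).trans (by linarith)
      · rw [hk₀, Nat.floor_of_nonpos h, Nat.cast_zero]
        positivity
    rw [Finset.sum_ite_eq']
    split_ifs
    · gcongr
    · positivity
  have hA : p * C * δ * ∑ k ∈ Finset.range (n + 1), b k * |W k| ≤ p * C * δ * 1 := by gcongr
  have hA' : 1 / (1 - p) * C * δ * (1 + ∑ k ∈ Finset.range (n + 1), b k * |W k|) ≤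
      1 / (1 - p) * C * δ * (1 + 1) := by gcongr
  calc _ ≤ p * C * δ * 1 + 1 / (1 - p) * C * δ * (1 + 1) + 1 / (1 - p) * K * (B / s) :=
        add_le_add (add_le_add hA hA') hlast
    _ = _ := by rw [hδ, hσ]; field_simp; ring

/-! ### Hamming balls compared with spheres -/

theorem choose_div_le_ballFraction (n k : ℕ) : (n.choose k : ℝ) / 2 ^ n ≤ ballFraction n k := by
  unfold ballFraction
  gcongr
  exact Finset.single_le_sum (f := fun j => (n.choose j : ℝ)) (fun _ _ => by positivity)
    (Finset.self_mem_range_succ k)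

theorem ballFraction_mono (n : ℕ) : Monotone (ballFraction n) := by
  intro j k h
  unfold ballFraction
  gcongr

/-- Shift the index: the j-th binomial coefficient is (j+1)/(n-j) times the next one, and this ratio
is at most r throughout the ball. -/
theorem ballFraction_le_mul_succ {n k : ℕ} {r : ℝ} (hr : 0 ≤ r)
    (hk : ((k + 1 : ℕ) : ℝ) ≤ r * (n - (k + 1 : ℕ))) :
    ballFraction n k ≤ r * ballFraction n (k + 1) := by
  unfold ballFraction
  rw [← mul_div_assoc]
  refine div_le_div_of_nonneg_right ?_ (by positivity)
  rw [Finset.sum_range_succ' _ (k + 1), mul_add]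
  have hkn : ((k + 1 : ℕ) : ℝ) < n := by
    have h0 : (0 : ℝ) < (k + 1 : ℕ) := by positivity
    by_contra! h
    have := mul_nonneg hr (sub_nonneg.mpr h)
    linarith
  have hterm : ∀ j ∈ Finset.range (k + 1), (n.choose j : ℝ) ≤ r * n.choose (j + 1) := fun j hj => by
    have hjk : ((j + 1 : ℕ) : ℝ) ≤ (k + 1 : ℕ) := by
      exact_mod_cast Nat.succ_le_of_lt (Finset.mem_range.mp hj)
    have hjn : j ≤ n := by
      have : ((j + 1 : ℕ) : ℝ) < n := by linarith
      have : j + 1 < n := by exact_mod_cast this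
      omega
    have h1 : (n.choose (j + 1) : ℝ) * (j + 1 : ℕ) = n.choose j * (n - j) := by
      rw [← Nat.cast_sub hjn]
      exact_mod_cast Nat.choose_succ_right_eq n j
    push_cast at *
    have hpos : (0 : ℝ) < n - j := by linarith
    refine le_of_mul_le_mul_right ?_ hpos
    rw [← h1, mul_comm r, mul_assoc]
    refine mul_le_mul_of_nonneg_left ?_ (Nat.cast_nonneg _)
    refine hjk.trans (hk.trans (mul_le_mul_of_nonneg_left ?_ hr))
    linarith
  have h := Finset.sum_le_sum hterm
  rw [← Finset.mul_sum] at h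
  have : 0 ≤ r * (n.choose 0 : ℝ) := by positivity
  linarith

theorem ballFraction_le_pow_mul {n K : ℕ} {r : ℝ} (hr : 0 ≤ r)
    (hK : (K : ℝ) ≤ r * (n - K)) {k : ℕ} (hk : k ≤ K) :
    ballFraction n k ≤ r ^ (K - k) * ballFraction n K := by
  induction K, hk using Nat.le_induction with
  | base => simp
  | succ K hk ih =>
    have hK' : (K : ℝ) ≤ r * (n - K) := by
      push_cast at hK
      linarith
    rw [Nat.succ_sub hk, pow_succ, mul_assoc]
    exact (ih hK').trans (mul_le_mul_of_nonneg_left (ballFraction_le_mul_succ hr hK) (by positivity))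

/-- The ball is its outer sphere plus the next smaller ball, which is at most r times the ball. -/
theorem mul_ballFraction_le {n K : ℕ} {r : ℝ} (hr : 0 ≤ r) (hK : (K : ℝ) ≤ r * (n - K)) :
    (1 - r) * ballFraction n K ≤ (n.choose K : ℝ) / 2 ^ n := by
  cases K with
  | zero =>
    have : 0 ≤ r * ballFraction n 0 := mul_nonneg hr (ballFraction_pos n 0).le
    have : ballFraction n 0 = (n.choose 0 : ℝ) / 2 ^ n := by simp [ballFraction]
    linarith
  | succ K =>
    have h1 := ballFraction_le_mul_succ hr hK
    have h2 : ballFraction n (K + 1) = ballFraction n K + (n.choose (K + 1) : ℝ) / 2 ^ n := by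
      unfold ballFraction
      rw [Finset.sum_range_succ _ (K + 1), add_div]
    linarith

/-! ### The RCU bound near the normal approximation -/

/-- The number of codewords at the normal approximation, times the proportion of a Hamming
sphere, in terms of the binomial mass. -/
theorem two_rpow_normalApprox_mul_choose {p : ℝ} (hp0 : 0 < p) (hp1 : p < 1 / 2) (e : ℝ) {n k : ℕ}
    (hn : 1 ≤ n) (hk : k ≤ n) :
    (2 : ℝ) ^ ((n : ℝ) * normalApprox (bscCapacity p) (bscDispersion p) n e) *
      ((n.choose k : ℝ) / 2 ^ n) =
    √n * binomialMass p n k * Real.exp ((k - (n * p + √(p * (1 - p)) * √n * gaussianQInv e)) *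
      Real.log ((1 - p) / p)) := by
  have hq : 0 < 1 - p := by linarith
  have hn0 : (0 : ℝ) < n := by exact_mod_cast hn
  have hs0 : 0 < √(n : ℝ) := Real.sqrt_pos.mpr hn0
  have hss : √(n : ℝ) * √n = n := Real.mul_self_sqrt hn0.le
  have hL : 0 < Real.log 2 := Real.log_pos one_lt_two
  have hθ : Real.log ((1 - p) / p) = Real.log (1 - p) - Real.log p := Real.log_div hq.ne' hp0.ne'
  have hθ0 : 0 ≤ Real.log ((1 - p) / p) :=
    Real.log_nonneg (by rw [le_div_iff₀ hp0]; linarith)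
  have hV : √(bscDispersion p / n) = √(p * (1 - p)) * Real.log ((1 - p) / p) / √n := by
    rw [bscDispersion, Real.sqrt_div' _ hn0.le, Real.sqrt_mul (by positivity), Real.sqrt_sq hθ0]
  have hexp : Real.log 2 * (n * normalApprox (bscCapacity p) (bscDispersion p) n e) =
      n * Real.log 2 - n * Real.binEntropy p -
        √(p * (1 - p)) * √n * gaussianQInv e * Real.log ((1 - p) / p) + Real.log n / 2 := by
    unfold normalApprox bscCapacity Real.logb
    rw [hV, Real.log_exp]
    have h : (n : ℝ) / √n = √n := by rw [div_eq_iff hs0.ne', hss]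
    calc _ = n * Real.log 2 - n * Real.binEntropy p - √(p * (1 - p)) * (n / √n) *
          gaussianQInv e * Real.log ((1 - p) / p) + Real.log n / 2 := by
          field_simp
      _ = _ := by rw [h]
  have h2n : (2 : ℝ) ^ n = Real.exp (n * Real.log 2) := by
    rw [Real.exp_nat_mul, Real.exp_log two_pos]
  have hsq : √(n : ℝ) = Real.exp (Real.log n / 2) := by
    rw [← Real.log_sqrt hn0.le, Real.exp_log hs0]
  have hpk : p ^ k = Real.exp (k * Real.log p) := by rw [Real.exp_nat_mul, Real.exp_log hp0]
  have hqk : (1 - p) ^ (n - k) = Real.exp ((n - k) * Real.log (1 - p)) := by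
    rw [← Nat.cast_sub hk, Real.exp_nat_mul, Real.exp_log hq]
  rw [Real.rpow_def_of_pos two_pos, hexp, binomialMass, h2n, hpk, hqk,
    div_eq_mul_inv (n.choose k : ℝ), ← Real.exp_neg]
  nth_rw 2 [hsq]
  have hcomb : ∀ a c₁ c₂ c₃ c₄ c₅ c₆ : ℝ, c₁ + c₂ = c₃ + c₄ + c₅ + c₆ →
      Real.exp c₁ * (a * Real.exp c₂) =
        Real.exp c₃ * (a * Real.exp c₄ * Real.exp c₅) * Real.exp c₆ := by
    intro a c₁ c₂ c₃ c₄ c₅ c₆ h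
    calc _ = a * Real.exp (c₁ + c₂) := by rw [Real.exp_add]; ring
      _ = _ := by rw [h, Real.exp_add, Real.exp_add, Real.exp_add]; ring
  refine hcomb _ _ _ _ _ _ _ ?_
  rw [Real.binEntropy, Real.log_inv, Real.log_inv, hθ]
  ring

/-- Points within `√n` of a given normal quantile lie in a window of width of order `√n`
around the mean. -/
theorem abs_sub_mean_le {p : ℝ} (hp0 : 0 < p) (hp1 : p < 1) {n : ℕ} {z x : ℝ}
    (h : |x - (n * p + √(p * (1 - p)) * √n * z)| ≤ √n) :
    |x - n * p| ≤ (|z| + 1) * √n := by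
  have hτ : √(p * (1 - p)) ≤ 1 := by
    rw [Real.sqrt_le_one]
    nlinarith
  have hz : |√(p * (1 - p)) * √n * z| ≤ 1 * √n * |z| := by
    rw [abs_mul, abs_of_nonneg (by positivity : 0 ≤ √(p * (1 - p)) * √n)]
    gcongr
  have := abs_add_le (x - (n * p + √(p * (1 - p)) * √n * z)) (√(p * (1 - p)) * √n * z)
  rw [show x - (n * p + √(p * (1 - p)) * √n * z) + √(p * (1 - p)) * √n * z = x - n * p by ring]
    at this
  linarith

theorem two_rpow_mul_add_logb_div {n : ℕ} (hn : 1 ≤ n) (N : ℝ) {X : ℝ} (hX : 0 < X) :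
    (2 : ℝ) ^ ((n : ℝ) * (N + Real.logb 2 X / n)) = (2 : ℝ) ^ ((n : ℝ) * N) * X := by
  have hn0 : (n : ℝ) ≠ 0 := by exact_mod_cast (Nat.one_le_iff_ne_zero.mp hn)
  rw [mul_add, mul_div_cancel₀ _ hn0, Real.rpow_add two_pos,
    Real.rpow_logb two_pos (by norm_num) hX]

theorem eventually_normalQuantile {p : ℝ} (hp0 : 0 < p) (hp1 : p < 1) (z K : ℝ) :
    ∀ᶠ n : ℕ in atTop, K ≤ n * p + √(p * (1 - p)) * √n * z := by
  filter_upwards [eventually_le_sqrt_natCast ((|z| + 1 + |K|) / p), eventually_le_sqrt_natCast 1]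
    with n h1 h2
  have hss : √(n : ℝ) * √n = n := Real.mul_self_sqrt (Nat.cast_nonneg n)
  have h := (abs_le.mp (abs_sub_mean_le hp0 hp1 (n := n) (z := z)
    (x := n * p + √(p * (1 - p)) * √n * z) (by simp))).1
  rw [div_le_iff₀ hp0] at h1
  have h3 : (|z| + 1 + |K|) * √n ≤ n * p := by
    have := mul_le_mul_of_nonneg_right h1 (Real.sqrt_nonneg (n : ℝ))
    rwa [show √(n : ℝ) * p * √n = √n * √n * p by ring, hss] at this
  have h4 : |K| * 1 ≤ |K| * √n := by gcongr
  linarith [le_abs_self K]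

/-- With slightly more codewords the minimum is saturated from B points below the quantile x on, so
the bound is at least P[k > x] plus B masses, and these pay for the Berry–Esseen error. -/
theorem exists_le_bscRCU_normalApprox {p : ℝ} (hp0 : 0 < p) (hp1 : p < 1 / 2) {e : ℝ} (he0 : 0 < e)
    (he1 : e < 1) : ∃ D : ℝ, ∀ᶠ n : ℕ in atTop,
      e ≤ bscRCU p n (normalApprox (bscCapacity p) (bscDispersion p) n e + D / n) := by
  have hp1' : p < 1 := by linarith
  set z := gaussianQInv e with hz
  have hQ : gaussianQ z = e := gaussianQ_gaussianQInv he0 he1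
  set θ := Real.log ((1 - p) / p) with hθ
  have hθ0 : 0 ≤ θ := Real.log_nonneg (by rw [le_div_iff₀ hp0]; linarith)
  obtain ⟨c, C, hc, hC, hwin⟩ := exists_binomialMass_window hp0 hp1' (|z| + 1)
  obtain ⟨E, hE0, hBE⟩ := exists_binomial_berryEsseen hp0 hp1' z
  -- B masses of size at least c/√n outweigh the error E/√n.
  obtain ⟨B, hB⟩ := exists_nat_ge (E / c)
  rw [div_le_iff₀ hc] at hB
  -- The point m - B is at most B + 1 below x (one from the floor); X makes up for the loss
  -- e^{-(B+1)θ} and for the constant c.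
  set X := Real.exp ((B + 1) * θ) / c with hX
  have hX0 : 0 < X := by positivity
  refine ⟨Real.logb 2 X, ?_⟩
  filter_upwards [hwin, hBE, eventually_le_sqrt_natCast (B + 1), eventually_ge_atTop 1,
    eventually_normalQuantile hp0 hp1' z B] with n hwin hBE hs hn hx0
  set s := √(n : ℝ)
  have hs0 : 0 < s := by
    have : (0 : ℝ) ≤ B := Nat.cast_nonneg B
    linarith
  set x := n * p + √(p * (1 - p)) * s * z with hx
  have hB0 : (0 : ℝ) ≤ B := Nat.cast_nonneg B
  set m := ⌊x⌋₊ with hm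
  have hm1 : (m : ℝ) ≤ x := Nat.floor_le (by linarith)
  have hm2 : x < m + 1 := Nat.lt_floor_add_one x
  have hBm : B ≤ m := Nat.le_floor hx0
  have hcast : ((m - B : ℕ) : ℝ) = m - B := Nat.cast_sub hBm
  have hin : ∀ k : ℕ, m - B ≤ k → k ≤ m → k ≤ n ∧ c / s ≤ binomialMass p n k := fun k h1 h2 => by
    have h1' : ((m - B : ℕ) : ℝ) ≤ k := by exact_mod_cast h1
    have h2' : (k : ℝ) ≤ m := by exact_mod_cast h2
    have := hwin k (abs_sub_mean_le hp0 hp1' (abs_le.mpr ⟨by linarith, by linarith⟩))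
    exact ⟨this.1, this.2.1⟩
  rw [bscRCU_eq hp0 hp1 hn, two_rpow_mul_add_logb_div hn _ hX0]
  have hsat : ∀ k, m - B ≤ k → 1 ≤ (2 : ℝ) ^ ((n : ℝ) * normalApprox (bscCapacity p)
      (bscDispersion p) n e) * X * ballFraction n k := by
    intro k hk
    obtain ⟨hkn, hkb⟩ := hin (m - B) le_rfl (Nat.sub_le _ _)
    have hid := two_rpow_normalApprox_mul_choose hp0 hp1 e hn hkn
    have hG := (choose_div_le_ballFraction n (m - B)).trans (ballFraction_mono n hk)
    have hexp : Real.exp (-((B + 1) * θ)) ≤ Real.exp ((((m - B : ℕ) : ℝ) - x) * θ) := by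
      rw [Real.exp_le_exp, ← neg_mul]
      exact mul_le_mul_of_nonneg_right (by linarith) hθ0
    calc (1 : ℝ) = X * (s * (c / s) * Real.exp (-((B + 1) * θ))) := by
          rw [hX, Real.exp_neg]; field_simp
      _ ≤ X * (s * binomialMass p n (m - B) * Real.exp ((((m - B : ℕ) : ℝ) - x) * θ)) := by
          have := binomialMass_nonneg hp0 hp1' n (m - B)
          gcongr
      _ = X * ((2 : ℝ) ^ ((n : ℝ) * normalApprox (bscCapacity p) (bscDispersion p) n e) *
            ((n.choose (m - B) : ℝ) / 2 ^ n)) := by rw [hid]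
      _ ≤ X * ((2 : ℝ) ^ ((n : ℝ) * normalApprox (bscCapacity p) (bscDispersion p) n e) *
            ballFraction n k) := by gcongr
      _ = _ := by ring
  set T := (Finset.range (n + 1)).filter (fun k : ℕ => x < (k : ℝ)) with hT
  have hdisj : Disjoint T (Finset.Ioc (m - B) m) := by
    rw [Finset.disjoint_left]
    intro k hk hk'
    have h1 : (k : ℝ) ≤ m := by exact_mod_cast (Finset.mem_Ioc.mp hk').2
    have h2 := (Finset.mem_filter.mp hk).2
    linarith
  have hsub : T ∪ Finset.Ioc (m - B) m ⊆ Finset.range (n + 1) := by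
    refine Finset.union_subset (Finset.filter_subset _ _) fun k hk => ?_
    rw [Finset.mem_Ioc] at hk
    exact Finset.mem_range.mpr (Nat.lt_succ_of_le (hin k hk.1.le hk.2).1)
  have hIoc : B * (c / s) ≤ ∑ k ∈ Finset.Ioc (m - B) m, binomialMass p n k := by
    have := Finset.card_nsmul_le_sum (Finset.Ioc (m - B) m) (binomialMass p n) (c / s) fun k hk =>
      (hin k (Finset.mem_Ioc.mp hk).1.le (Finset.mem_Ioc.mp hk).2).2
    rwa [Nat.card_Ioc, Nat.sub_sub_self hBm, nsmul_eq_mul] at this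
  have hBE' := (abs_le.mp hBE).1
  rw [hQ] at hBE'
  have hEs : E / s ≤ B * (c / s) := by rw [← mul_div_assoc]; gcongr
  calc e ≤ ∑ k ∈ T, binomialMass p n k + ∑ k ∈ Finset.Ioc (m - B) m, binomialMass p n k := by
        linarith
    _ = ∑ k ∈ T ∪ Finset.Ioc (m - B) m, binomialMass p n k := (Finset.sum_union hdisj).symm
    _ ≤ ∑ k ∈ T ∪ Finset.Ioc (m - B) m, binomialMass p n k * min 1 ((2 : ℝ) ^ ((n : ℝ) *
          normalApprox (bscCapacity p) (bscDispersion p) n e) * X * ballFraction n k) := by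
        refine Finset.sum_le_sum fun k hk => ?_
        rw [min_eq_left (hsat k ?_), mul_one]
        rcases Finset.mem_union.mp hk with h | h
        · have h1 : (m : ℝ) < k := hm1.trans_lt (Finset.mem_filter.mp h).2
          have h2 : m < k := by exact_mod_cast h1
          omega
        · exact (Finset.mem_Ioc.mp h).1.le
    _ ≤ _ := Finset.sum_le_sum_of_subset_of_nonneg hsub fun k _ _ =>
        mul_nonneg (binomialMass_nonneg hp0 hp1' n k)
          (le_min zero_le_one (mul_nonneg (by positivity) (ballFraction_pos n k).le))

/-- With slightly fewer codewords the minimum is saturated at most from K, B points above the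
quantile, on. Below K a geometric series contributes O(1/√n); above K there is P[k > x] less B
masses, and B is large enough to win. -/
theorem exists_bscRCU_normalApprox_le {p : ℝ} (hp0 : 0 < p) (hp1 : p < 1 / 2) {e : ℝ} (he0 : 0 < e)
    (he1 : e < 1) : ∃ D : ℝ, ∀ᶠ n : ℕ in atTop,
      bscRCU p n (normalApprox (bscCapacity p) (bscDispersion p) n e - D / n) ≤ e := by
  have hp1' : p < 1 := by linarith
  have hq : 0 < 1 - p := by linarith
  set z := gaussianQInv e with hz
  have hQ : gaussianQ z = e := gaussianQ_gaussianQInv he0 he1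
  set θ := Real.log ((1 - p) / p) with hθ
  have hθ0 : 0 ≤ θ := Real.log_nonneg (by rw [le_div_iff₀ hp0]; linarith)
  -- The ratio K/(n-K) tends to p/(1-p) < 1, so any r strictly between is eventually a valid decay
  -- rate for balls of radius up to K.
  obtain ⟨r, hr0, hr1, hrp⟩ : ∃ r : ℝ, 0 < r ∧ r < 1 ∧ 0 < r * (1 - p) - p := by
    obtain ⟨r, h1, h2⟩ := exists_between (show p / (1 - p) < 1 by rw [div_lt_one hq]; linarith)
    refine ⟨r, (div_pos hp0 hq).trans h1, h2, ?_⟩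
    rw [div_lt_iff₀ hq] at h1
    linarith
  have hr1' : 0 < 1 - r := by linarith
  obtain ⟨c, _, hc, _, hwin⟩ := exists_binomialMass_window hp0 hp1' (|z| + 1)
  obtain ⟨C, hC, htail⟩ := exists_binomialMass_le hp0 hp1' (|z| + 1)
  obtain ⟨E, hE0, hBE⟩ := exists_binomial_berryEsseen hp0 hp1' z
  -- B masses must cover both the Berry–Esseen error and the geometric series.
  obtain ⟨B, hB⟩ := exists_nat_ge ((E + C / (1 - r)) / c)
  rw [div_le_iff₀ hc] at hB
  -- Chosen so that the codeword count times the ball of radius K is at most 1: C bounds the mass,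
  -- 1/(1-r) passes from sphere to ball, and K exceeds x by at most B.
  set X := C * Real.exp (B * θ) / (1 - r) with hX
  have hX0 : 0 < X := by positivity
  refine ⟨Real.logb 2 X, ?_⟩
  filter_upwards [hwin, htail, hBE, eventually_le_sqrt_natCast (B + 1), eventually_ge_atTop 1,
    eventually_normalQuantile hp0 hp1' z 0,
    eventually_le_sqrt_natCast ((1 + r) * (|z| + 1) / (r * (1 - p) - p))]
    with n hwin htail hBE hs hn hx0 hrs
  have hss : √(n : ℝ) * √n = n := Real.mul_self_sqrt (Nat.cast_nonneg n)
  set s := √(n : ℝ)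
  have hB0 : (0 : ℝ) ≤ B := Nat.cast_nonneg B
  have hs0 : 0 < s := by linarith
  set x := n * p + √(p * (1 - p)) * s * z with hx
  set m := ⌊x⌋₊ with hm
  have hm1 : (m : ℝ) ≤ x := Nat.floor_le hx0
  have hm2 : x < m + 1 := Nat.lt_floor_add_one x
  have hwindow : ∀ k : ℕ, m ≤ k → k ≤ m + B → |(k : ℝ) - n * p| ≤ (|z| + 1) * s := fun k h1 h2 => by
    have h1' : (m : ℝ) ≤ k := by exact_mod_cast h1
    have h2' : (k : ℝ) ≤ m + B := by exact_mod_cast h2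
    exact abs_sub_mean_le hp0 hp1' (abs_le.mpr ⟨by linarith, by linarith⟩)
  have hin : ∀ k : ℕ, m ≤ k → k ≤ m + B → k ≤ n ∧ c / s ≤ binomialMass p n k := fun k h1 h2 =>
    ⟨(hwin k (hwindow k h1 h2)).1, (hwin k (hwindow k h1 h2)).2.1⟩
  set K := m + B with hK
  have hKcast : (K : ℝ) = m + B := by rw [hK]; push_cast; ring
  have hKwin := (abs_le.mp (hwindow K (by omega) le_rfl)).2
  have hKr : (K : ℝ) ≤ r * (n - K) := by
    rw [div_le_iff₀ hrp] at hrs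
    have h1 : (1 + r) * ((K : ℝ) - n * p) ≤ (1 + r) * ((|z| + 1) * s) := by gcongr
    have h2 := mul_le_mul_of_nonneg_right hrs hs0.le
    rw [show s * (r * (1 - p) - p) * s = s * s * (r * (1 - p) - p) by ring, hss] at h2
    linarith
  rw [sub_eq_add_neg, ← neg_div, ← Real.logb_inv, bscRCU_eq hp0 hp1 hn,
    two_rpow_mul_add_logb_div hn _ (inv_pos.mpr hX0)]
  set M := (2 : ℝ) ^ ((n : ℝ) * normalApprox (bscCapacity p) (bscDispersion p) n e) * X⁻¹ with hM
  have hM0 : 0 ≤ M := by positivity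
  have hcap : M * ballFraction n K ≤ 1 := by
    have hid := two_rpow_normalApprox_mul_choose hp0 hp1 e hn (hin K (by omega) le_rfl).1
    have hG := mul_ballFraction_le hr0.le hKr
    have hexp : Real.exp (((K : ℝ) - x) * θ) ≤ Real.exp (B * θ) := by
      rw [Real.exp_le_exp]
      exact mul_le_mul_of_nonneg_right (by linarith) hθ0
    have hbK : binomialMass p n K ≤ C / s := htail K (by linarith)
    refine le_of_mul_le_mul_left ?_ hr1'
    calc (1 - r) * (M * ballFraction n K) = M * ((1 - r) * ballFraction n K) := by ring
      _ ≤ M * ((n.choose K : ℝ) / 2 ^ n) := by gcongr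
      _ = X⁻¹ * (s * binomialMass p n K * Real.exp (((K : ℝ) - x) * θ)) := by
          rw [← hid, hM]; ring
      _ ≤ X⁻¹ * (s * (C / s) * Real.exp (B * θ)) := by gcongr
      _ = (1 - r) * 1 := by rw [hX]; field_simp
  have hlow : ∑ k ∈ Finset.range (K + 1), binomialMass p n k * min 1 (M * ballFraction n k) ≤
      C / (1 - r) / s := by
    calc _ ≤ ∑ k ∈ Finset.range (K + 1), C / s * r ^ (K - k) := by
          refine Finset.sum_le_sum fun k hk => ?_
          have hkK : k ≤ K := Nat.lt_succ_iff.mp (Finset.mem_range.mp hk)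
          have hkK' : (k : ℝ) ≤ K := by exact_mod_cast hkK
          have h1 : min 1 (M * ballFraction n k) ≤ r ^ (K - k) := by
            refine (min_le_right _ _).trans ?_
            calc M * ballFraction n k ≤ M * (r ^ (K - k) * ballFraction n K) :=
                  mul_le_mul_of_nonneg_left (ballFraction_le_pow_mul hr0.le hKr hkK) hM0
              _ = r ^ (K - k) * (M * ballFraction n K) := by ring
              _ ≤ r ^ (K - k) * 1 := by gcongr
              _ = _ := mul_one _
          refine mul_le_mul (htail k (by linarith)) h1 ?_ (by positivity)
          exact le_min zero_le_one (mul_nonneg hM0 (ballFraction_pos n k).le)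
      _ = C / s * ∑ k ∈ Finset.range (K + 1), r ^ k := by
          rw [← Finset.mul_sum, ← Finset.sum_range_reflect (fun k => r ^ k)]
          simp
      _ ≤ C / s * (1 - r)⁻¹ := by
          gcongr
          rw [← one_div, le_div_iff₀ hr1', geom_sum_mul_neg]
          linarith [pow_nonneg hr0.le (K + 1)]
      _ = _ := by ring
  set T := (Finset.range (n + 1)).filter (fun k : ℕ => x < (k : ℝ)) with hT
  have hIoc : B * (c / s) ≤ ∑ k ∈ Finset.Ioc m K, binomialMass p n k := by
    have := Finset.card_nsmul_le_sum (Finset.Ioc m K) (binomialMass p n) (c / s) fun k hk =>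
      (hin k (Finset.mem_Ioc.mp hk).1.le (Finset.mem_Ioc.mp hk).2).2
    rwa [Nat.card_Ioc, hK, Nat.add_sub_cancel_left, nsmul_eq_mul] at this
  have hIocT : Finset.Ioc m K ⊆ T := fun k hk => by
    rw [Finset.mem_Ioc] at hk
    have h1 : (m : ℝ) + 1 ≤ k := by exact_mod_cast hk.1
    exact Finset.mem_filter.mpr
      ⟨Finset.mem_range.mpr (Nat.lt_succ_of_le (hin k hk.1.le hk.2).1), by linarith⟩
  have hhigh : ∑ k ∈ T \ Finset.Ioc m K, binomialMass p n k ≤ e + E / s - B * (c / s) := by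
    have h1 := Finset.sum_sdiff (f := binomialMass p n) hIocT
    have h2 := (abs_le.mp hBE).2
    rw [hQ] at h2
    linarith
  have hcover : Finset.range (n + 1) ⊆ Finset.range (K + 1) ∪ (T \ Finset.Ioc m K) := fun k hk => by
    rw [Finset.mem_union, Finset.mem_sdiff, Finset.mem_Ioc, Finset.mem_range, Finset.mem_filter]
    by_cases h : k < K + 1
    · exact Or.inl h
    · refine Or.inr ⟨⟨hk, ?_⟩, by omega⟩
      have : m + 1 ≤ k := by omega
      have : (m : ℝ) + 1 ≤ k := by exact_mod_cast this
      linarith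
  have hdisj : Disjoint (Finset.range (K + 1)) (T \ Finset.Ioc m K) := by
    rw [Finset.disjoint_left]
    intro k hk hk'
    rw [Finset.mem_sdiff, Finset.mem_Ioc, Finset.mem_filter] at hk'
    have h1 : (m : ℝ) < k := hm1.trans_lt hk'.1.2
    have h2 : m < k := by exact_mod_cast h1
    exact hk'.2 ⟨h2, Nat.lt_succ_iff.mp (Finset.mem_range.mp hk)⟩
  have hnn : ∀ k, 0 ≤ binomialMass p n k * min 1 (M * ballFraction n k) := fun k =>
    mul_nonneg (binomialMass_nonneg hp0 hp1' n k)
      (le_min zero_le_one (mul_nonneg hM0 (ballFraction_pos n k).le))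
  have hfin : (E + C / (1 - r)) / s ≤ B * (c / s) := by rw [← mul_div_assoc]; gcongr
  rw [add_div] at hfin
  calc _ ≤ ∑ k ∈ Finset.range (K + 1) ∪ (T \ Finset.Ioc m K),
          binomialMass p n k * min 1 (M * ballFraction n k) :=
        Finset.sum_le_sum_of_subset_of_nonneg hcover fun k _ _ => hnn k
    _ = _ := Finset.sum_union hdisj
    _ ≤ C / (1 - r) / s + ∑ k ∈ T \ Finset.Ioc m K, binomialMass p n k :=
        add_le_add hlow (Finset.sum_le_sum fun k _ => mul_le_of_le_one_right
          (binomialMass_nonneg hp0 hp1' n k) (min_le_left _ _))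
    _ ≤ e := by linarith

theorem mainTheorem5 (p : ℝ) (hp0 : 0 < p) (hp1 : p < 1 / 2)
    (Pe : ℝ) (hPe0 : 0 < Pe) (hPe1 : Pe < 1) :
    (∀ n : ℕ, 1 ≤ n →
      IsGreatest {R : ℝ | bscRCU p n R ≤ Pe} (bscRCURate p n Pe) ∧
      ∀ R : ℝ, bscRCU p n R = Pe ↔ R = bscRCURate p n Pe) ∧
    (fun n : ℕ => bscRCURate p n Pe
        - normalApprox (bscCapacity p) (bscDispersion p) n Pe)
      =O[atTop] (fun n : ℕ => 1 / (n : ℝ)) := by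
  refine ⟨fun n hn => bscRCURate_spec hp0 hp1 hn hPe0 hPe1, ?_⟩
  obtain ⟨D₁, h₁⟩ := exists_le_bscRCU_normalApprox hp0 hp1 hPe0 hPe1
  obtain ⟨D₂, h₂⟩ := exists_bscRCU_normalApprox_le hp0 hp1 hPe0 hPe1
  refine IsBigO.of_bound (max D₁ D₂) ?_
  filter_upwards [h₁, h₂, eventually_ge_atTop 1] with n h₁ h₂ hn
  rw [Real.norm_eq_abs, Real.norm_of_nonneg (by positivity), mul_one_div]
  refine abs_bscRCURate_sub_le hp0 hp1 hn hPe0 hPe1 ?_ ?_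
  · refine (bscRCU_monotone hp0 hp1 hn ?_).trans h₂
    gcongr
    exact le_max_right _ _
  · refine h₁.trans (bscRCU_monotone hp0 hp1 hn ?_)
    gcongr
    exact le_max_left _ _
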